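/- **Setting.** There are $n\ge 1$ buyers $1,\dots,n$ and $m\ge 1$ sellers $1,\dots,m$, a set $E$ of pairs (buyer, seller) that may trade, valuations $v_i>0$ of the buyers and $\rho_j>0$ of the sellers, and budgets $B_i\in[0,\infty]$ of the buyers. For each seller $j$, let $E_j$ be the set of pairs in $E$ containing $j$, and let $f_j:2^{E_j}\to\mathbb R_+$ be monotone and submodular with $f_j(\emptyset)=0$. All participants report truthfully. For each seller $j$ add a virtual buyer $n+j$, adjacent only to $j$, with $v_{n+j}=\rho_j$ and $B_{n+j}=\infty$; add the pair $(n+j,j)$ to $E_j$, and extend $f_j$ by giving every set that contains this pair the value of $f_j$ at the original $E_j$. From now on $N=\{1,\dots,n+m\}$, and $E=\bigcup_jE_j$ and $f_j$ are the modified ones. Let $E_S$ be the set of pairs containing a buyer of $S\subseteq N$, let $f(F)=\sum_jf_j(F\cap E_j)$, and let $P=\{w\in\mathbb R_+^E: w(F)\le f_j(F)\text{ for all } j \text{ and } F\subseteq E_j\}$. Let $v_{\max}$ and $v_{\min}$ be the maximum and minimum of $v_i$ over $i\in N$. **Greedy allocation.** For $i\in N$ let $H_i$ be the set of buyers $k$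 with $v_k>v_i$, or with $v_k=v_i$ and $k>i$. The liquid-welfare-optimal greedy allocation $x^*$ is defined recursively by $$x_i^*=\min\Bigl(\frac{B_i}{v_i},\ \min_{H\subseteq H_i}\bigl\{f(E_{H\cup\{i\}})-x^*(H)\bigr\}\Bigr)\qquad(i\in N).$$ **Auction.** Let $\varepsilon>0$ be such that every $v_i$ $(i\in N)$ is an integer multiple of $\varepsilon$. The polyhedral clinching auction keeps transactions $w\in\mathbb R_+^E$, payments $p_i$, price clocks $c_i$ and demands $d_i\in[0,\infty]$ $(i\in N)$. It starts with $w=0$, $p=0$, $c=0$, $d_i=\infty$ for all $i$, and $l=1$. As long as some $d_i\neq0$, it repeats the following two steps. 1. *Clinching.* For $i=1,\dots,n+m$ in this order, with the current values of all variables: let $$P_{w,d}=\{y\in\mathbb R^E_+: w+y\in P,\ y(E_k)\le d_k\ (k\in N)\},$$ and for $\xi\in\mathbb R_+^{E_i}$ let $$P^i_{w,d}(\xi)=\{(y(E_k))_{k\in N\setminus i}: y\in P_{w,d},\ y|_{E_i}=\xi\}.$$ Choose any (componentwise) maximal $\xi\in\mathbb R_+^{E_i}$ with $P^i_{w,d}(\xi)=P^i_{w,d}(0)$.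 Add $c_i\,\xi(E_i)$ to $p_i$, add $\xi$ to $w|_{E_i}$, and then set $d_i=(B_i-p_i)/c_i$ if $c_i<v_i$ (read as $\infty$ if $c_i=0$) and $d_i=0$ otherwise. 2. *Price update.* Add $\varepsilon$ to $c_l$, set $d_l=(B_l-p_l)/c_l$ if $c_l<v_l$ and $d_l=0$ otherwise, and replace $l$ by $l+1$ (by $1$ if $l=n+m$). For $i\in N$ let $x^{\rm f}_i=w(E_i)$ and $p^{\rm f}_i=p_i$ be taken at the end of the auction. **Theorem.** If $v_{\max}=v_{\min}$ or $\varepsilon\le \dfrac{v_{\min}^2}{v_{\max}-v_{\min}}$, then, for every choice of the maximal vectors $\xi$, $$\sum_{i\in N:\ x^{\rm f}_i>x^*_i}p^{\rm f}_i+\sum_{i\in N:\ x^{\rm f}_i\le x^*_i}v_i x^{\rm f}_i\ \ge\ \sum_{i\in N:\ x^{\rm f}_i\le x^*_i}v_i x^*_i .$$ -/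

import Mathlib

open scoped ENNReal

/-- `f` restricted to the subsets of `A` is a monotone submodular set function (normalised by
`f ∅ = 0`, hence nonnegative). -/
structure IsMonotoneSubmodularOn {α : Type*} [DecidableEq α] (A : Finset α)
    (f : Finset α → ℝ) : Prop where
  empty : f ∅ = 0
  mono : ∀ S T : Finset α, S ⊆ T → T ⊆ A → f S ≤ f T
  submod : ∀ S T : Finset α, S ⊆ T → T ⊆ A → ∀ e ∈ A, e ∉ T →
    f (insert e T) - f T ≤ f (insert e S) - f S

/-- A two-sided market with `n` buyers and `m` sellers, in which everybody reports truthfully.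
An edge `(i, j) ∈ E_j` at seller `j` is identified with its buyer `i`, so that `f j` is a set
function on sets of buyers; only its values on sets of buyers adjacent to `j` matter. -/
structure Market (n m : ℕ) where
  /-- the pairs (buyer, seller) that are willing to trade -/
  E : Finset (Fin n × Fin m)
  /-- the monotone submodular function of each seller's polymatroid -/
  f : Fin m → Finset (Fin n) → ℝ
  /-- the buyers' valuations for one unit -/
  v : Fin n → ℝ
  /-- the sellers' valuations for one unit -/
  ρ : Fin m → ℝ
  /-- the buyers' budgets, possibly infinite -/
  B : Fin n → ℝ≥0∞
  f_submodular : ∀ j, IsMonotoneSubmodularOn (Finset.univ.filter fun i => (i, j) ∈ E) (f j)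
  v_pos : ∀ i, 0 < v i
  ρ_pos : ∀ j, 0 < ρ j

/-- State of the auction: transactions `w`, payments `p`, price clocks `c`, demands `d`, and the
(zero-based) number `l` of the buyer whose clock is incremented next. -/
@[ext] structure AuctionState (n m : ℕ) where
  w : Fin (n + m) → Fin m → ℝ
  p : Fin (n + m) → ℝ
  c : Fin (n + m) → ℝ
  d : Fin (n + m) → ℝ≥0∞
  l : ℕ

namespace AuctionState

variable {n m : ℕ}

/-- The amount of goods `x_i = w(E_i)` that buyer `i` has obtained. -/
def x (s : AuctionState n m) (i : Fin (n + m)) : ℝ := ∑ j, s.w i j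

end AuctionState

namespace Market

variable {n m : ℕ} (I : Market n m)

/-! ### The modified market

Buyers are numbered by `Fin (n + m)`: the first `n` are the original buyers, and the last `m` are
the virtual buyers, one for each seller. -/

/-- The original buyers adjacent to seller `j`. -/
def origNbrs (j : Fin m) : Finset (Fin n) := Finset.univ.filter fun i => (i, j) ∈ I.E

/-- The buyers adjacent to seller `j` in the modified market, that is, the edge set `E_j`. -/
def nbrs (j : Fin m) : Finset (Fin (n + m)) :=
  insert (Fin.natAdd n j) ((I.origNbrs j).map (Fin.castAddEmb m))

/-- The submodular function of seller `j` in the modified market. -/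
def sellerFn (j : Fin m) (F : Finset (Fin (n + m))) : ℝ :=
  if Fin.natAdd n j ∈ F then I.f j (I.origNbrs j)
  else I.f j (Finset.univ.filter fun i : Fin n => Fin.castAdd m i ∈ F)

/-- The value `f(E_S)` for a set `S` of buyers, where `f(F) = ∑ j, f_j(F ∩ E_j)`. -/
def total (S : Finset (Fin (n + m))) : ℝ := ∑ j, I.sellerFn j (S ∩ I.nbrs j)

/-- The valuations of the buyers of the modified market. -/
def value : Fin (n + m) → ℝ := Fin.append I.v I.ρ

/-- The budgets of the buyers of the modified market. -/
def budget : Fin (n + m) → ℝ≥0∞ := Fin.append I.B fun _ => ⊤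

/-- The largest valuation in the modified market. -/
noncomputable def vMax : ℝ := ⨆ i, I.value i

/-- The smallest valuation in the modified market. -/
noncomputable def vMin : ℝ := ⨅ i, I.value i

/-! ### The greedy liquid-welfare optimal allocation -/

/-- The buyers that precede `i` in the greedy order: those with a higher valuation, and those
with the same valuation and a larger number. -/
noncomputable def before (i : Fin (n + m)) : Finset (Fin (n + m)) :=
  Finset.univ.filter fun k => I.value i < I.value k ∨ (I.value k = I.value i ∧ i < k)

theorem before_card_lt {i k : Fin (n + m)} (hk : k ∈ I.before i) :
    (I.before k).card < (I.before i).card := by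
  apply Finset.card_lt_card
  rw [Finset.ssubset_iff_of_subset]
  · exact ⟨k, hk, by simp [before]⟩
  · intro a ha
    simp only [before, Finset.mem_filter, Finset.mem_univ, true_and] at ha hk ⊢
    rcases ha with ha | ⟨ha, ha'⟩ <;> rcases hk with hk | ⟨hk, hk'⟩
    · exact Or.inl (hk.trans ha)
    · exact Or.inl (hk ▸ ha)
    · exact Or.inl (ha ▸ hk)
    · exact Or.inr ⟨ha.trans hk, hk'.trans ha'⟩

/-- `min (B_i / v_i) t`, where the budget may be infinite. -/
noncomputable def capByBudget (i : Fin (n + m)) (t : ℝ) : ℝ :=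
  if I.budget i = ⊤ then t else min ((I.budget i).toReal / I.value i) t

/-- The greedy allocation
`x*_i = min (B_i / v_i) (min_{H ⊆ H_i} (f(E_{H ∪ {i}}) - x*(H)))`, with `H_i = before i`.
(See `xOpt_eq` for this equation without the membership test, which serves the recursion.) -/
noncomputable def xOpt (i : Fin (n + m)) : ℝ :=
  I.capByBudget i ((I.before i).powerset.inf' ⟨∅, Finset.empty_mem_powerset _⟩ fun H =>
    I.total (insert i H) - ∑ k ∈ H, if _h : k ∈ I.before i then xOpt k else 0)
termination_by (I.before i).card
decreasing_by exact I.before_card_lt _h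

theorem xOpt_eq (i : Fin (n + m)) :
    I.xOpt i = I.capByBudget i ((I.before i).powerset.inf' ⟨∅, Finset.empty_mem_powerset _⟩
      fun H => I.total (insert i H) - ∑ k ∈ H, I.xOpt k) := by
  rw [xOpt]
  congr 1
  refine Finset.inf'_congr _ rfl fun H hH => ?_
  congr 1
  refine Finset.sum_congr rfl fun k hk => ?_
  rw [dif_pos (Finset.mem_powerset.1 hH hk)]

/-! ### The polyhedral clinching auction -/

/-- The polymatroid `P` of feasible transactions of the modified market. -/
def feasible : Set (Fin (n + m) → Fin m → ℝ) :=
  {w | (∀ i j, 0 ≤ w i j) ∧ (∀ i j, i ∉ I.nbrs j → w i j = 0) ∧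
    ∀ j, ∀ F ⊆ I.nbrs j, ∑ i ∈ F, w i j ≤ I.sellerFn j F}

/-- The remnant supply polytope `P_{w,d}`. -/
def remnant (w : Fin (n + m) → Fin m → ℝ) (d : Fin (n + m) → ℝ≥0∞) :
    Set (Fin (n + m) → Fin m → ℝ) :=
  {y | (∀ i j, 0 ≤ y i j) ∧ (∀ i j, i ∉ I.nbrs j → y i j = 0) ∧
    w + y ∈ I.feasible ∧ ∀ i, ENNReal.ofReal (∑ j, y i j) ≤ d i}

/-- The set `P^i_{w,d}(ξ)` of future transactions of the other buyers if `i` clinches `ξ`. -/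
def othersAfter (w : Fin (n + m) → Fin m → ℝ) (d : Fin (n + m) → ℝ≥0∞) (i : Fin (n + m))
    (ξ : Fin m → ℝ) : Set ({k : Fin (n + m) // k ≠ i} → ℝ) :=
  {u | ∃ y ∈ I.remnant w d, y i = ξ ∧ ∀ k, ∑ j, y k.1 j = u k}

/-- The clinching polytope `P^i_{w,d}`. -/
def clinchPolytope (w : Fin (n + m) → Fin m → ℝ) (d : Fin (n + m) → ℝ≥0∞) (i : Fin (n + m)) :
    Set (Fin m → ℝ) :=
  {ξ | (∀ j, 0 ≤ ξ j) ∧ (∀ j, i ∉ I.nbrs j → ξ j = 0) ∧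
    I.othersAfter w d i ξ = I.othersAfter w d i 0}

/-- The demand of buyer `i` at price `c` after payments `p`: `(B_i - p) / c` if `c < v_i`
(which is `∞` at price `0`), and `0` otherwise. -/
noncomputable def demand (i : Fin (n + m)) (c p : ℝ) : ℝ≥0∞ :=
  if c < I.value i then
    if c = 0 then ⊤ else (I.budget i - ENNReal.ofReal p) / ENNReal.ofReal c
  else 0

/-- The state after buyer `i` clinches `ξ` at the price `c_i`. -/
noncomputable def afterClinch (s : AuctionState n m) (i : Fin (n + m)) (ξ : Fin m → ℝ) :
    AuctionState n m :=
  { s with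
    w := Function.update s.w i (s.w i + ξ)
    p := Function.update s.p i (s.p i + s.c i * ∑ j, ξ j)
    d := Function.update s.d i (I.demand i (s.c i) (s.p i + s.c i * ∑ j, ξ j)) }

/-- Buyer `i` clinches some maximal vector of her clinching polytope. -/
def ClinchStep (i : Fin (n + m)) (s s' : AuctionState n m) : Prop :=
  ∃ ξ : Fin m → ℝ, Maximal (· ∈ I.clinchPolytope s.w s.d i) ξ ∧ s' = I.afterClinch s i ξ

/-- All buyers clinch, one after the other, in the order of their numbers. -/
def ClinchRound (s s' : AuctionState n m) : Prop :=
  ∃ σ : Fin (n + m + 1) → AuctionState n m, σ 0 = s ∧ σ (Fin.last _) = s' ∧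
    ∀ i : Fin (n + m), I.ClinchStep i (σ i.castSucc) (σ i.succ)

/-- The price clock of buyer number `l` is incremented by `ε`, her demand is updated, and it is
the next buyer's turn (cyclically). -/
noncomputable def priceUpdate (ε : ℝ) (s : AuctionState n m) : AuctionState n m :=
  { s with
    c := fun i => if (i : ℕ) = s.l then s.c i + ε else s.c i
    d := fun i => if (i : ℕ) = s.l then I.demand i (s.c i + ε) (s.p i) else s.d i
    l := (s.l + 1) % (n + m) }

/-- One iteration of the auction, performed as long as some demand is nonzero. -/
def Iteration (ε : ℝ) (s s' : AuctionState n m) : Prop :=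
  (∃ i, s.d i ≠ 0) ∧ ∃ t, I.ClinchRound s t ∧ s' = I.priceUpdate ε t

/-- The initial state of the auction. -/
def initState (n m : ℕ) : AuctionState n m where
  w := 0
  p := 0
  c := 0
  d := fun _ => ⊤
  l := 0

/-- `s` is a final state of a run of the polyhedral clinching auction with increment `ε`. The
choice of the maximal clinched vectors is arbitrary. -/
def IsFinalState (ε : ℝ) (s : AuctionState n m) : Prop :=
  Relation.ReflTransGen (I.Iteration ε) (initState n m) s ∧ ∀ i, s.d i = 0

end Market

/-! Measure values and prices in steps of size ε, so that `K i` is the value of buyer `i`. The loss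
v_k (x*_k − x_k) of a buyer `k` is ε times her deficit x*_k − x_k, summed over the levels a < `K k`.
The payment of `i` is ε times the sum over a of what she bought at prices of at least a + 1 steps.
So it suffices to bound, level by level, the deficits of the buyers with `K k` ≥ a + 1 by what the
buyers with an excess x_i > x*_i bought at high prices (`Invariant.sum_deficit_level_le`), and to
add up the levels (`Invariant.sum_deficit_le_sum_pay`).

The bound at a level comes from certificates. When `i` clinches a positive amount, there is a set T
without `i` such that all goods are used up if T takes its full share f(E_T), `i` keeps what she
has, and every other buyer gets her whole demand (`Consistent.exists_tight_of_clinch`). A buyer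
whose price is below her value has amount plus demand at least x*_k (`xOpt_le_add_demand`). Amount
plus demand never grows, and in the end everything is sold, so the deficits outside T are at most
what `i` buys later, minus the slack of T (`Certificate.sum_deficit_le`). Inside T another
certificate is used. Submodularity of the slack lets the certificates be combined (`Covers`).

The clocks differ by up to one step: a certificate of `i` issued at a steps says nothing about a
buyer with a smaller number and value a + 1. If x*_i is not limited by the budget, `i` lies in a set
that is tight for x* and consists of buyers preceding her in the greedy order; outside such sets
deficits are balanced by excesses, and inside them ties favour larger numbers (`covers_of_tight`).
If x*_i = B_i / v_i, the level is shifted by one, and the smallness of ε pays for the shift: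
original buyers buy nothing below v_min, so v_min x_i ≤ B_i = v_i x*_i (`Invariant.sum_min_le_pay`).

All this needs control of the auction itself. `Consistent` says that amounts allowed by the
aggregated polymatroid are realised on the edges and that the remaining goods can be sold. After a
full clinching round they can even be sold without any one given buyer, so lowering one demand does
no harm. -/

/-- A normalised monotone submodular set function on the finite subsets of `α`. -/
structure IsPolymatroid {α : Type*} [DecidableEq α] (h : Finset α → ℝ) : Prop where
  empty : h ∅ = 0
  mono : ∀ S T : Finset α, S ⊆ T → h S ≤ h T
  submod : ∀ S T : Finset α, h (S ∪ T) + h (S ∩ T) ≤ h S + h T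

/-- Membership in the polymatroid with rank function `h`. -/
def Independent {α : Type*} (h : Finset α → ℝ) (u : α → ℝ) : Prop :=
  (∀ a, 0 ≤ u a) ∧ ∀ S : Finset α, ∑ a ∈ S, u a ≤ h S

/-! ### Polymatroids: augmentation, contraction, aggregation. -/

section Polymatroid

variable {α β : Type*}

theorem Independent.mono {h : Finset α → ℝ} {u v : α → ℝ} (hu : Independent h u)
    (hv : ∀ a, 0 ≤ v a) (hvu : ∀ a, v a ≤ u a) : Independent h v :=
  ⟨hv, fun S => (Finset.sum_le_sum fun a _ => hvu a).trans (hu.2 S)⟩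

theorem Independent.aggregate [Fintype α] [DecidableEq β] {h : Finset α → ℝ}
    {y : α → ℝ} (hy : Independent h y) (φ : α → β) : Independent (fun B : Finset β => h (Finset.univ.filter fun a => φ a ∈ B))
      fun b => ∑ a with φ a = b, y a := by
  refine ⟨fun b => Finset.sum_nonneg fun a _ => hy.1 a, fun B => ?_⟩
  refine le_trans (le_of_eq ?_) (hy.2 _)
  rw [← Finset.sum_fiberwise_of_maps_to (s := Finset.univ.filter fun a => φ a ∈ B) (t := B)
    (g := φ) (by simp)]
  refine Finset.sum_congr rfl fun b hb => Finset.sum_congr ?_ fun _ _ => rfl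
  ext a
  simp only [Finset.mem_filter, Finset.mem_univ, true_and]
  exact ⟨fun h => ⟨h ▸ hb, h⟩, fun h => h.2⟩

/-- Optimality criterion: on `T` the vector `u` attains the rank, off `T` it dominates. Typically
the coordinates off `T` have reached their caps. -/
theorem Independent.sum_le_of_tight [Fintype α] [DecidableEq α] {h : Finset α → ℝ} {u u' : α → ℝ}
    (hu' : Independent h u') {T : Finset α} (hT : ∑ a ∈ T, u a = h T)
    (hoff : ∀ a ∉ T, u' a ≤ u a) : ∑ a, u' a ≤ ∑ a, u a := by
  rw [← Finset.sum_add_sum_compl T u', ← Finset.sum_add_sum_compl T u]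
  have h1 := hu'.2 T
  have h2 := Finset.sum_le_sum fun a (ha : a ∈ Tᶜ) => hoff a (Finset.mem_compl.1 ha)
  linarith

variable [DecidableEq α] [DecidableEq β]

theorem tight_union {h : Finset α → ℝ} (hh : IsPolymatroid h) {u : α → ℝ}
    (hu : Independent h u) {S T : Finset α} (hS : ∑ a ∈ S, u a = h S) (hT : ∑ a ∈ T, u a = h T) :
    ∑ a ∈ S ∪ T, u a = h (S ∪ T) := by
  have h1 := Finset.sum_union_inter (s₁ := S) (s₂ := T) (f := u)
  have h2 := hu.2 (S ∪ T)
  have h3 := hu.2 (S ∩ T)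
  have h4 := hh.submod S T
  linarith

theorem sum_add_single {u : α → ℝ} (b : α) (η : ℝ) (S : Finset α) :
    ∑ a ∈ S, (u a + if a = b then η else 0) = ∑ a ∈ S, u a + if b ∈ S then η else 0 := by
  rw [Finset.sum_add_distrib, Finset.sum_ite_eq' S b]

/-- An independent vector can be increased on the coordinates in `B` until each of them has
reached its cap or lies in a common tight set. -/
theorem exists_augment [Fintype α] {h : Finset α → ℝ} (hh : IsPolymatroid h) {u : α → ℝ}
    (hu : Independent h u) (cap : α → ℝ) (B : Finset α) (hcap : ∀ b ∈ B, u b ≤ cap b) :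
    ∃ u' T, Independent h u' ∧ (∀ a, u a ≤ u' a) ∧ (∀ a ∉ B, u' a = u a) ∧
      (∀ b ∈ B, u' b ≤ cap b) ∧ ∑ a ∈ T, u' a = h T ∧ ∀ b ∈ B, b ∉ T → u' b = cap b := by
  induction B using Finset.induction_on with
  | empty => exact ⟨u, ∅, hu, fun _ => le_rfl, by simp, by simp, by simp [hh.empty], by simp⟩
  | insert b B hb ih =>
    obtain ⟨u', T, h1, h2, h3, h4, h5, h6⟩ := ih fun x hx => hcap x (Finset.mem_insert_of_mem hx)
    obtain ⟨S, hS, hmin⟩ := Finset.exists_min_image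
      (Finset.univ.filter fun S : Finset α => b ∈ S) (fun S => h S - ∑ a ∈ S, u' a)
      ⟨{b}, by simp⟩
    simp only [Finset.mem_filter, Finset.mem_univ, true_and] at hS hmin
    -- The coordinate `b` is raised until a set containing it becomes tight or the cap is reached.
    set η := min (h S - ∑ a ∈ S, u' a) (cap b - u' b) with hη
    have hη1 : η ≤ h S - ∑ a ∈ S, u' a := min_le_left _ _
    have hη2 : η ≤ cap b - u' b := min_le_right _ _
    have hη0 : 0 ≤ η := by
      have := h1.2 S
      have := hcap b (Finset.mem_insert_self _ _)
      rw [← h3 b hb] at this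
      exact le_min (by linarith) (by linarith)
    have hind : Independent h fun a => u' a + if a = b then η else 0 := by
      refine ⟨fun a => add_nonneg (h1.1 a) (by split_ifs <;> simp [hη0]), fun Q => ?_⟩
      rw [sum_add_single]
      split_ifs with hQ
      · have := hmin Q hQ
        linarith
      · simpa using h1.2 Q
    -- If `b` lies in the tight set `T`, minimality of `S` forces η = 0, so `T` stays tight.
    have hT : ∑ a ∈ T, (u' a + if a = b then η else 0) = h T := by
      rw [sum_add_single]
      split_ifs with hbT
      · have := hmin T hbT
        linarith
      · simpa using h5
    have hother : ∀ a, a ≠ b → (u' a + if a = b then η else 0) = u' a := fun a ha => by simp [ha]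
    have base : ∀ Q : Finset α, T ⊆ Q →
        ∑ a ∈ Q, (u' a + if a = b then η else 0) = h Q → (b ∉ Q → u' b + η = cap b) →
        ∃ u' T, Independent h u' ∧ (∀ a, u a ≤ u' a) ∧ (∀ a ∉ insert b B, u' a = u a) ∧
        (∀ b' ∈ insert b B, u' b' ≤ cap b') ∧ ∑ a ∈ T, u' a = h T ∧
        ∀ b' ∈ insert b B, b' ∉ T → u' b' = cap b' := by
      intro Q hTQ hQ hbQ
      refine ⟨_, Q, hind, ?_, ?_, ?_, hQ, ?_⟩
      · intro a
        have := h2 a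
        split_ifs <;> linarith
      · intro a ha
        simp only [Finset.mem_insert, not_or] at ha
        rw [hother a ha.1, h3 a ha.2]
      · intro a ha
        by_cases hab : a = b
        · subst hab
          simp only [if_true]
          linarith
        · rw [hother a hab]
          exact h4 a ((Finset.mem_insert.1 ha).resolve_left hab)
      · intro a ha haQ
        by_cases hab : a = b
        · subst hab
          simpa using hbQ haQ
        · rw [hother a hab]
          exact h6 a ((Finset.mem_insert.1 ha).resolve_left hab) fun h => haQ (hTQ h)
    rcases le_total (h S - ∑ a ∈ S, u' a) (cap b - u' b) with hle | hle
    · refine base (T ∪ S) Finset.subset_union_left (tight_union hh hind hT ?_)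
        fun hb' => absurd (Finset.mem_union_right _ hS) hb'
      rw [sum_add_single, if_pos hS, hη, min_eq_left hle]
      ring
    · refine base T subset_rfl hT fun _ => ?_
      rw [hη, min_eq_right hle]
      ring

/-- The rank function of the vectors that can be added to `w`. -/
noncomputable def contractBy [Fintype α] (h : Finset α → ℝ) (w : α → ℝ) (F : Finset α) : ℝ :=
  (Finset.univ.filter fun F' : Finset α => F ⊆ F').inf' ⟨F, by simp⟩ fun F' => h F' - ∑ a ∈ F', w a

theorem contractBy_le [Fintype α] (h : Finset α → ℝ) (w : α → ℝ) {F F' : Finset α}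
    (hF : F ⊆ F') : contractBy h w F ≤ h F' - ∑ a ∈ F', w a :=
  Finset.inf'_le (fun F' => h F' - ∑ a ∈ F', w a) (by simpa using hF)

theorem exists_contractBy_eq [Fintype α] (h : Finset α → ℝ) (w : α → ℝ) (F : Finset α) :
    ∃ F', F ⊆ F' ∧ contractBy h w F = h F' - ∑ a ∈ F', w a := by
  obtain ⟨F', hF', h1⟩ := Finset.exists_mem_eq_inf'
    (s := Finset.univ.filter fun F' : Finset α => F ⊆ F') ⟨F, by simp⟩
    fun F' => h F' - ∑ a ∈ F', w a
  exact ⟨F', by simpa using hF', h1⟩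

theorem isPolymatroid_contractBy [Fintype α] {h : Finset α → ℝ} (hh : IsPolymatroid h)
    {w : α → ℝ} (hw : Independent h w) : IsPolymatroid (contractBy h w) where
  empty := by
    apply le_antisymm
    · simpa [hh.empty] using contractBy_le h w (F := ∅) (F' := ∅) subset_rfl
    · obtain ⟨F, _, h1⟩ := exists_contractBy_eq h w ∅
      rw [h1]
      linarith [hw.2 F]
  mono S T hST := by
    obtain ⟨F, hF, h1⟩ := exists_contractBy_eq h w T
    rw [h1]
    exact contractBy_le h w (hST.trans hF)
  submod S T := by
    obtain ⟨F, hF, h1⟩ := exists_contractBy_eq h w S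
    obtain ⟨F', hF', h2⟩ := exists_contractBy_eq h w T
    rw [h1, h2]
    have h3 := contractBy_le h w (Finset.union_subset_union hF hF')
    have h4 := contractBy_le h w (Finset.inter_subset_inter hF hF')
    have h5 := hh.submod F F'
    have h6 := Finset.sum_union_inter (s₁ := F) (s₂ := F') (f := w)
    linarith

/-- Since `y` is nonnegative, its sum over S is at most its sum over the superset that attains the
minimum, so the constraints of the two sides agree. -/
theorem independent_contractBy_iff [Fintype α] {h : Finset α → ℝ} {w y : α → ℝ}
    (hw : Independent h w) :
    Independent (contractBy h w) y ↔ (∀ a, 0 ≤ y a) ∧ Independent h (w + y) := by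
  refine ⟨fun hy => ⟨hy.1, fun a => add_nonneg (hw.1 a) (hy.1 a), fun S => ?_⟩,
    fun hy => ⟨hy.1, fun S => ?_⟩⟩
  · have h1 := hy.2 S
    have h2 := contractBy_le h w (subset_refl S)
    simp only [Pi.add_apply, Finset.sum_add_distrib]
    linarith
  · obtain ⟨F, hF, h1⟩ := exists_contractBy_eq h w S
    have h2 := hy.2.2 F
    simp only [Pi.add_apply, Finset.sum_add_distrib] at h2
    have h3 := Finset.sum_le_sum_of_subset_of_nonneg hF fun a _ _ => hy.1 a
    linarith

theorem isPolymatroid_comap [Fintype α] {h : Finset α → ℝ} (hh : IsPolymatroid h) (φ : α → β) :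
    IsPolymatroid fun B : Finset β => h (Finset.univ.filter fun a => φ a ∈ B) where
  empty := by simpa using hh.empty
  mono S T hST := hh.mono _ _ fun a => by simpa using fun h => hST h
  submod S T := by
    have := hh.submod (Finset.univ.filter fun a => φ a ∈ S) (Finset.univ.filter fun a => φ a ∈ T)
    convert this using 3 <;> ext a <;> simp

/-- Every independent vector of an aggregated polymatroid is the aggregation of an independent
vector. -/
theorem exists_independent_aggregate_eq [Fintype α] [Fintype β] {h : Finset α → ℝ}
    (hh : IsPolymatroid h) (φ : α → β) {z : β → ℝ}
    (hz : Independent (fun B : Finset β => h (Finset.univ.filter fun a => φ a ∈ B)) z) :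
    ∃ y, Independent h y ∧ ∀ b, ∑ a with φ a = b, y a = z b := by
  -- The vector `z` is distributed one element at a time: elements of `D` hold their final value
  -- `y`, and `r` is the rest of `z`, still owed to the elements of each fibre outside `D`.
  have key : ∀ D : Finset α, ∃ (y : α → ℝ) (r : β → ℝ), (∀ a, 0 ≤ y a) ∧ (∀ b, 0 ≤ r b) ∧
      (∀ a ∉ D, y a = 0) ∧ (∀ b, ∑ a with φ a = b, y a + r b = z b) ∧
      ∀ F ⊆ D, ∀ S : Finset β, ∑ a ∈ F, y a + ∑ b ∈ S, r b ≤
        h (F ∪ Finset.univ.filter fun a => φ a ∈ S ∧ a ∉ D) := by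
    intro D
    induction D using Finset.induction_on with
    | empty =>
      refine ⟨0, z, by simp, hz.1, by simp, by simp, fun F hF S => ?_⟩
      simpa [Finset.subset_empty.1 hF] using hz.2 S
    | insert a D ha ih =>
      obtain ⟨y, r, hy, hr, hyD, hsum, hFS⟩ := ih
      set X : Finset β → Finset α := fun S => Finset.univ.filter fun a => φ a ∈ S ∧ a ∉ D with hX
      have hmemX : ∀ S x, x ∈ X S ↔ φ x ∈ S ∧ x ∉ D := fun S x => by simp [hX]
      -- the largest value that the coordinate `a` can take
      obtain ⟨⟨F₀, S₀⟩, h₀, hmin⟩ := Finset.exists_min_image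
        (D.powerset ×ˢ Finset.univ.filter fun S : Finset β => φ a ∉ S)
        (fun p => h (insert a (p.1 ∪ X p.2)) - (∑ x ∈ p.1, y x + ∑ b ∈ p.2, r b))
        ⟨(∅, ∅), by simp⟩
      simp only [Finset.mem_product, Finset.mem_powerset, Finset.mem_filter, Finset.mem_univ,
        true_and, Prod.forall, and_imp] at h₀ hmin
      obtain ⟨hF₀, hS₀⟩ := h₀
      set t₀ := h (insert a (F₀ ∪ X S₀)) - (∑ x ∈ F₀, y x + ∑ b ∈ S₀, r b) with ht₀
      set t := min (r (φ a)) t₀ with ht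
      have ht1 : t ≤ r (φ a) := min_le_left _ _
      have ht2 : t ≤ t₀ := min_le_right _ _
      have hpos : 0 ≤ t := by
        refine le_min (hr _) ?_
        have h1 := hFS F₀ hF₀ S₀
        have h2 := hh.mono _ _ (Finset.subset_insert a (F₀ ∪ X S₀))
        linarith
      have hX' : ∀ S : Finset β, (Finset.univ.filter fun x => φ x ∈ S ∧ x ∉ insert a D) =
          (X S).erase a := fun S => by
        ext x
        simp only [Finset.mem_filter, Finset.mem_univ, true_and, Finset.mem_insert, not_or,
          Finset.mem_erase, hmemX]
        tauto
      -- the remaining elements of the fibre can take the rest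
      have hrest : ∀ F ⊆ D, ∀ S : Finset β, φ a ∈ S →
          ∑ x ∈ F, y x + ∑ b ∈ S, r b - t ≤ h (F ∪ (X S).erase a) := by
        intro F hF S haS
        have haF : a ∉ F := fun h => ha (hF h)
        rcases le_total (r (φ a)) t₀ with hle | hle
        · rw [ht, min_eq_left hle]
          have h1 := hFS F hF (S.erase (φ a))
          have h2 : h (F ∪ X (S.erase (φ a))) ≤ h (F ∪ (X S).erase a) := by
            refine hh.mono _ _ (Finset.union_subset_union subset_rfl fun x hx => ?_)
            simp only [hmemX, Finset.mem_erase] at hx ⊢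
            exact ⟨fun hxa => hx.1.1 (by rw [hxa]), hx.1.2, hx.2⟩
          have h3 := Finset.add_sum_erase S r haS
          have h4 : ∑ x ∈ F, y x + ∑ b ∈ S.erase (φ a), r b ≤ h (F ∪ X (S.erase (φ a))) := h1
          linarith
        -- Here the new element is stopped by the tight set `insert a (F₀ ∪ X S₀)`. Uncrossing it
        -- with `F ∪ (X S).erase a` shows that the fibre without `a` can still absorb the rest.
        · rw [ht, min_eq_right hle]
          have h1 := hFS (F₀ ∪ F) (Finset.union_subset hF₀ hF) (S₀ ∪ S)
          have h2 := hFS (F₀ ∩ F) (Finset.inter_subset_left.trans hF₀) (S₀ ∩ S)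
          have h3 := hh.submod (insert a (F₀ ∪ X S₀)) (F ∪ (X S).erase a)
          have h4 : insert a (F₀ ∪ X S₀) ∪ (F ∪ (X S).erase a) = F₀ ∪ F ∪ X (S₀ ∪ S) := by
            ext x
            by_cases hxa : x = a
            · subst hxa
              simp [hmemX, haS, ha]
            · simp only [Finset.mem_union, Finset.mem_insert, hmemX, Finset.mem_erase, hxa]
              tauto
          have h5 : insert a (F₀ ∪ X S₀) ∩ (F ∪ (X S).erase a) = F₀ ∩ F ∪ X (S₀ ∩ S) := by
            ext x
            by_cases hxa : x = a
            · subst hxa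
              simp [hmemX, hS₀, haF]
            · have hxF : x ∈ F → x ∈ D := fun h => hF h
              have hxF₀ : x ∈ F₀ → x ∈ D := fun h => hF₀ h
              simp only [Finset.mem_union, Finset.mem_insert, Finset.mem_inter, hmemX,
                Finset.mem_erase, hxa]
              tauto
          rw [h4, h5] at h3
          have h6 := Finset.sum_union_inter (s₁ := F₀) (s₂ := F) (f := y)
          have h7 := Finset.sum_union_inter (s₁ := S₀) (s₂ := S) (f := r)
          change _ ≤ h (F₀ ∪ F ∪ X (S₀ ∪ S)) at h1
          change _ ≤ h (F₀ ∩ F ∪ X (S₀ ∩ S)) at h2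
          linarith
      refine ⟨fun x => y x + if x = a then t else 0,
        fun b => r b + if b = φ a then -t else 0, ?_, ?_, ?_, ?_, ?_⟩
      · exact fun x => add_nonneg (hy x) (by split_ifs <;> simp [hpos])
      · intro b
        dsimp only
        split_ifs with hb
        · subst hb
          linarith
        · simpa using hr b
      · intro x hx
        simp only [Finset.mem_insert, not_or] at hx
        simp [hx.1, hyD x hx.2]
      · intro b
        rw [sum_add_single, ← hsum b]
        simp only [Finset.mem_filter, Finset.mem_univ, true_and, @eq_comm _ b]
        split_ifs <;> ring
      · intro F hF S
        rw [sum_add_single, sum_add_single, hX']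
        have hsub : F.erase a ⊆ D := fun x hx =>
          (Finset.mem_insert.1 (hF (Finset.mem_of_mem_erase hx))).resolve_left
            (Finset.ne_of_mem_erase hx)
        have hold : ∑ x ∈ F.erase a, y x + ∑ b ∈ S, r b ≤ h (F.erase a ∪ X S) := hFS _ hsub S
        have hya : y a = 0 := hyD a ha
        by_cases haF : a ∈ F
        · have h1 := Finset.add_sum_erase F y haF
          rw [if_pos haF]
          by_cases haS : φ a ∈ S
          · rw [if_pos haS]
            have h2 : F.erase a ∪ X S = F ∪ (X S).erase a := by
              ext x
              by_cases hxa : x = a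
              · subst hxa
                simp [hmemX, haS, ha, haF]
              · simp [hxa]
            rw [h2] at hold
            linarith
          · rw [if_neg haS]
            have h2 : insert a (F.erase a ∪ X S) = F ∪ (X S).erase a := by
              ext x
              by_cases hxa : x = a
              · subst hxa
                simp [haF]
              · simp [hxa]
            have h3 := hmin (F.erase a) S hsub haS
            rw [h2] at h3
            linarith
        · rw [Finset.erase_eq_of_notMem haF] at hsub hold
          rw [if_neg haF]
          by_cases haS : φ a ∈ S
          · rw [if_pos haS]
            have := hrest F hsub S haS
            linarith
          · rw [if_neg haS]
            have h2 : (X S).erase a = X S :=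
              Finset.erase_eq_of_notMem fun h => haS ((hmemX S a).1 h).1
            rw [h2]
            linarith
  obtain ⟨y, r, hy, hr, -, hsum, hFS⟩ := key Finset.univ
  -- Once `D` is everything, no fibre element is left, so what remains of `z` is bounded by the rank
  -- of the empty set.
  have hr0 : ∀ b, r b = 0 := fun b => by
    refine le_antisymm ?_ (hr b)
    simpa [hh.empty] using hFS ∅ (by simp) {b}
  refine ⟨y, ⟨hy, fun S => ?_⟩, fun b => by simpa [hr0] using hsum b⟩
  simpa using hFS S (by simp) ∅

end Polymatroid

theorem IsMonotoneSubmodularOn.union_add_inter_le {α : Type*} [DecidableEq α] {A : Finset α}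
    {f : Finset α → ℝ} (hf : IsMonotoneSubmodularOn A f) {S T : Finset α} (hS : S ⊆ A)
    (hT : T ⊆ A) : f (S ∪ T) + f (S ∩ T) ≤ f S + f T := by
  -- Diminishing returns of single elements are added up along `U`; the case `U = T \ S` is the
  -- lattice inequality.
  have key : ∀ U : Finset α, U ⊆ A → Disjoint U S →
      f (S ∪ U) - f S ≤ f (S ∩ T ∪ U) - f (S ∩ T) := by
    intro U
    induction U using Finset.induction_on with
    | empty => simp
    | insert e U he ih =>
      intro hU hd
      rw [Finset.insert_subset_iff] at hU
      rw [Finset.disjoint_insert_left] at hd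
      have h1 := ih hU.2 hd.2
      have h2 := hf.submod (S ∩ T ∪ U) (S ∪ U)
        (Finset.union_subset_union Finset.inter_subset_left subset_rfl)
        (Finset.union_subset hS hU.2) e hU.1 (by simp [he, hd.1])
      rw [Finset.union_insert, Finset.union_insert]
      linarith
  have h1 := key (T \ S) (Finset.sdiff_subset.trans hT) Finset.sdiff_disjoint
  have h2 : S ∩ T ∪ T \ S = T := by
    rw [Finset.inter_comm, Finset.union_comm, Finset.sdiff_union_inter]
  rw [Finset.union_sdiff_self_eq_union, h2] at h1
  linarith

/-! ### The market as a polymatroid on edges and on buyers. -/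

namespace Market

variable {n m : ℕ} (I : Market n m)

/-- A set with the virtual pair has the full value of the seller. If `S` or `T` contains the pair,
submodularity therefore reduces to monotonicity; otherwise it is that of the original function. -/
theorem isPolymatroid_sellerFn (j : Fin m) :
    IsPolymatroid fun S : Finset (Fin (n + m)) => I.sellerFn j (S ∩ I.nbrs j) := by
  have hf := I.f_submodular j
  have hsub : ∀ S : Finset (Fin (n + m)),
      (Finset.univ.filter fun i : Fin n => Fin.castAdd m i ∈ S ∩ I.nbrs j) ⊆ I.origNbrs j := by
    intro S i
    simp only [nbrs, Finset.mem_filter, Finset.mem_univ, true_and, Finset.mem_inter,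
      Finset.mem_insert, Finset.mem_map, Fin.castAddEmb_apply]
    rintro ⟨-, h | ⟨a, ha, h⟩⟩
    · have := congrArg Fin.val h
      simp at this
      omega
    · rwa [← Fin.castAdd_injective n m h]
  have hv : Fin.natAdd n j ∈ I.nbrs j := Finset.mem_insert_self _ _
  refine ⟨?_, ?_, ?_⟩
  · simpa [sellerFn] using hf.empty
  · intro S T hST
    simp only [sellerFn, Finset.mem_inter, hv, and_true]
    split_ifs with h1 h2 h2
    · exact le_rfl
    · exact absurd (hST h1) h2
    · exact hf.mono _ _ (by simpa using hsub S) subset_rfl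
    · refine hf.mono _ _ (fun i => ?_) (by simpa [origNbrs] using hsub T)
      simp only [Finset.mem_filter, Finset.mem_univ, true_and]
      exact fun h => ⟨hST h.1, h.2⟩
  · intro S T
    have hmono : ∀ S T : Finset (Fin (n + m)), S ⊆ T →
        I.f j (Finset.univ.filter fun i : Fin n => Fin.castAdd m i ∈ S ∩ I.nbrs j) ≤
        I.f j (Finset.univ.filter fun i : Fin n => Fin.castAdd m i ∈ T ∩ I.nbrs j) := by
      intro S T hST
      refine hf.mono _ _ (fun i => ?_) (hsub T)
      simp only [Finset.mem_filter, Finset.mem_univ, true_and, Finset.mem_inter]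
      exact fun h => ⟨hST h.1, h.2⟩
    have hSI := hmono (S ∩ T) S Finset.inter_subset_left
    have hTI := hmono (S ∩ T) T Finset.inter_subset_right
    have hlat := hf.union_add_inter_le (hsub S) (hsub T)
    have e1 : (Finset.univ.filter fun i : Fin n => Fin.castAdd m i ∈ S ∩ I.nbrs j) ∪
        (Finset.univ.filter fun i : Fin n => Fin.castAdd m i ∈ T ∩ I.nbrs j) =
        Finset.univ.filter fun i : Fin n => Fin.castAdd m i ∈ (S ∪ T) ∩ I.nbrs j := by
      ext i
      simp only [Finset.mem_union, Finset.mem_filter, Finset.mem_univ, true_and, Finset.mem_inter]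
      tauto
    have e2 : (Finset.univ.filter fun i : Fin n => Fin.castAdd m i ∈ S ∩ I.nbrs j) ∩
        (Finset.univ.filter fun i : Fin n => Fin.castAdd m i ∈ T ∩ I.nbrs j) =
        Finset.univ.filter fun i : Fin n => Fin.castAdd m i ∈ S ∩ T ∩ I.nbrs j := by
      ext i
      simp only [Finset.mem_filter, Finset.mem_univ, true_and, Finset.mem_inter]
      tauto
    rw [e1, e2] at hlat
    have hST := Finset.mem_union (s := S) (t := T) (a := Fin.natAdd n j)
    have hST' := Finset.mem_inter (s₁ := S) (s₂ := T) (a := Fin.natAdd n j)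
    simp only [sellerFn, Finset.mem_inter (s₂ := I.nbrs j) (a := Fin.natAdd n j), hv, and_true,
      hST, hST']
    by_cases h1 : Fin.natAdd n j ∈ S <;> by_cases h2 : Fin.natAdd n j ∈ T <;>
      simp only [h1, h2, true_or, or_true, and_true, and_self, or_self, if_true, if_false,
        and_false] <;> linarith

/-- The sum of the sellers' functions, as a function of a set of buyer-seller pairs. -/
noncomputable def edgeFn (F : Finset (Fin (n + m) × Fin m)) : ℝ :=
  ∑ j, I.sellerFn j ((Finset.univ.filter fun i => (i, j) ∈ F) ∩ I.nbrs j)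

theorem isPolymatroid_edgeFn : IsPolymatroid I.edgeFn where
  empty := Finset.sum_eq_zero fun j _ => by
    simpa using (I.isPolymatroid_sellerFn j).empty
  mono S T hST := Finset.sum_le_sum fun j _ => by
    refine (I.isPolymatroid_sellerFn j).mono _ _ fun i => ?_
    simpa using fun h => hST h
  submod S T := by
    simp only [edgeFn, ← Finset.sum_add_distrib]
    refine Finset.sum_le_sum fun j _ => ?_
    have := (I.isPolymatroid_sellerFn j).submod (Finset.univ.filter fun i => (i, j) ∈ S)
      (Finset.univ.filter fun i => (i, j) ∈ T)
    convert this using 4 <;> ext i <;> simp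

theorem total_eq_edgeFn (S : Finset (Fin (n + m))) :
    I.total S = I.edgeFn (Finset.univ.filter fun a => a.1 ∈ S) := by
  simp [total, edgeFn]

theorem isPolymatroid_total : IsPolymatroid I.total := by
  have := isPolymatroid_comap I.isPolymatroid_edgeFn Prod.fst
  convert this using 2 with S
  exact I.total_eq_edgeFn S

theorem sum_pairs (w : Fin (n + m) → Fin m → ℝ) (F : Finset (Fin (n + m) × Fin m)) :
    ∑ a ∈ F, w a.1 a.2 = ∑ j, ∑ i with (i, j) ∈ F, w i j := by
  have h1 : ∑ a ∈ F, w a.1 a.2 = ∑ a, if a ∈ F then w a.1 a.2 else 0 := by simp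
  rw [h1, Fintype.sum_prod_type_right]
  exact Finset.sum_congr rfl fun j _ => by rw [Finset.sum_filter]

/-- The sellers' constraints live on disjoint sets of pairs, so they add up to one polymatroid;
pairs that may not trade have rank zero, which forces `w` to vanish there. -/
theorem mem_feasible_iff {w : Fin (n + m) → Fin m → ℝ} :
    w ∈ I.feasible ↔ Independent I.edgeFn fun a => w a.1 a.2 := by
  constructor
  · rintro ⟨h0, hE, hF⟩
    refine ⟨fun a => h0 _ _, fun F => ?_⟩
    rw [sum_pairs]
    refine Finset.sum_le_sum fun j _ => ?_
    refine le_trans (le_of_eq ?_) (hF j _ Finset.inter_subset_right)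
    symm
    apply Finset.sum_subset Finset.inter_subset_left
    intro i hi hi'
    exact hE i j fun h => hi' (Finset.mem_inter.2 ⟨hi, h⟩)
  · rintro ⟨h0, hF⟩
    have key : ∀ j F, ∑ i ∈ F, w i j ≤ I.sellerFn j (F ∩ I.nbrs j) := by
      intro j F
      have h1 := hF (F ×ˢ {j})
      rw [Finset.sum_product] at h1
      simp only [Finset.sum_singleton] at h1
      refine h1.trans (le_of_eq ?_)
      rw [edgeFn, Finset.sum_eq_single j]
      · simp
      · intro j' _ hj'
        rw [← (I.isPolymatroid_sellerFn j').empty]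
        simp [hj'.symm]
      · simp
    refine ⟨fun i j => h0 (i, j), fun i j hij => le_antisymm ?_ (h0 (i, j)), fun j F hF' => ?_⟩
    · have := key j {i}
      rwa [Finset.sum_singleton, Finset.singleton_inter_of_notMem hij,
        ← Finset.empty_inter (I.nbrs j), (I.isPolymatroid_sellerFn j).empty] at this
    · have := key j F
      rwa [Finset.inter_eq_left.2 hF'] at this

theorem independent_total_of_mem_feasible {w : Fin (n + m) → Fin m → ℝ} (hw : w ∈ I.feasible) :
    Independent I.total fun k => ∑ j, w k j := by
  have h1 := (I.mem_feasible_iff.1 hw).aggregate Prod.fst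
  have h2 : (fun B => I.edgeFn (Finset.univ.filter fun a => a.1 ∈ B)) = I.total :=
    funext fun S => (I.total_eq_edgeFn S).symm
  rw [h2] at h1
  convert h1 using 2 with k
  rw [Finset.sum_filter, Fintype.sum_prod_type, Finset.sum_eq_single k] <;> simp +contextual

theorem exists_mem_feasible {z : Fin (n + m) → ℝ} (hz : Independent I.total z) :
    ∃ w ∈ I.feasible, ∀ k, ∑ j, w k j = z k := by
  have h2 : (fun B => I.edgeFn (Finset.univ.filter fun a => a.1 ∈ B)) = I.total :=
    funext fun S => (I.total_eq_edgeFn S).symm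
  rw [← h2] at hz
  obtain ⟨y, hy, hyz⟩ := exists_independent_aggregate_eq I.isPolymatroid_edgeFn Prod.fst hz
  refine ⟨fun k j => y (k, j), I.mem_feasible_iff.2 hy, fun k => ?_⟩
  rw [← hyz k, Finset.sum_filter, Fintype.sum_prod_type, Finset.sum_eq_single k] <;>
    simp +contextual

theorem mem_remnant_iff {w y : Fin (n + m) → Fin m → ℝ} {d : Fin (n + m) → ℝ≥0∞}
    (hw : w ∈ I.feasible) : y ∈ I.remnant w d ↔ (∀ k j, 0 ≤ y k j) ∧ w + y ∈ I.feasible ∧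
      ∀ k, ENNReal.ofReal (∑ j, y k j) ≤ d k := by
  refine ⟨fun h => ⟨h.1, h.2.2⟩, fun h => ⟨h.1, fun k j hk => ?_, h.2⟩⟩
  have h1 := h.2.1.2.1 k j hk
  have h2 := hw.2.1 k j hk
  simpa [h2] using h1

/-! ### Splitting one buyer into her edges -/

/-- The edges of buyer `i` are kept apart, those of any other buyer are merged. -/
def splitMap (i : Fin (n + m)) (a : Fin (n + m) × Fin m) : Fin (n + m) ⊕ Fin m :=
  if a.1 = i then Sum.inr a.2 else Sum.inl a.1

/-- The rank function of the remaining supply in terms of the total amounts of the buyers other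
than `i` and the amounts on the edges of `i`. -/
noncomputable def splitFn (w : Fin (n + m) → Fin m → ℝ) (i : Fin (n + m))
    (B : Finset (Fin (n + m) ⊕ Fin m)) : ℝ :=
  contractBy I.edgeFn (fun a => w a.1 a.2) (Finset.univ.filter fun a => splitMap i a ∈ B)

theorem isPolymatroid_splitFn {w : Fin (n + m) → Fin m → ℝ} (hw : w ∈ I.feasible)
    (i : Fin (n + m)) : IsPolymatroid (I.splitFn w i) :=
  isPolymatroid_comap (isPolymatroid_contractBy I.isPolymatroid_edgeFn (I.mem_feasible_iff.1 hw)) _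

theorem sum_splitMap_inr (i : Fin (n + m)) (j : Fin m) (y : Fin (n + m) × Fin m → ℝ) :
    ∑ a with splitMap i a = Sum.inr j, y a = y (i, j) := by
  have : (Finset.univ.filter fun a : Fin (n + m) × Fin m => splitMap i a = Sum.inr j) =
      {(i, j)} := by
    ext ⟨k, l⟩
    rw [Finset.mem_filter]
    by_cases hk : k = i <;> simp [splitMap, hk]
  rw [this, Finset.sum_singleton]

theorem sum_splitMap_inl (i k : Fin (n + m)) (y : Fin (n + m) × Fin m → ℝ) :
    ∑ a with splitMap i a = Sum.inl k, y a = if k = i then 0 else ∑ j, y (k, j) := by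
  rw [Finset.sum_filter, Fintype.sum_prod_type]
  split_ifs with hk
  · subst hk
    refine Finset.sum_eq_zero fun a _ => Finset.sum_eq_zero fun j _ => ?_
    by_cases ha : a = k <;> simp [splitMap, ha]
  · rw [Finset.sum_eq_single k]
    · simp [splitMap, hk]
    · intro a _ hak
      refine Finset.sum_eq_zero fun j _ => ?_
      by_cases ha : a = i <;> simp [splitMap, ha, hak]
    · simp

/-- Only the totals of the other buyers matter in the definition of clinching. By aggregation their
edges can be merged without losing feasibility information, while the edges of `i` stay visible. -/
theorem independent_splitFn_iff {w : Fin (n + m) → Fin m → ℝ} (hw : w ∈ I.feasible)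
    {i : Fin (n + m)} {z : Fin (n + m) → ℝ} (hz : z i = 0) {ζ : Fin m → ℝ} :
    Independent (I.splitFn w i) (Sum.elim z ζ) ↔ ∃ y : Fin (n + m) → Fin m → ℝ,
      (∀ k j, 0 ≤ y k j) ∧ w + y ∈ I.feasible ∧ y i = ζ ∧ ∀ k, k ≠ i → ∑ j, y k j = z k := by
  have hw' := I.mem_feasible_iff.1 hw
  have hpoly := isPolymatroid_contractBy I.isPolymatroid_edgeFn hw'
  constructor
  · intro h
    obtain ⟨y, hy, hyz⟩ := exists_independent_aggregate_eq hpoly (splitMap i) h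
    rw [independent_contractBy_iff hw'] at hy
    refine ⟨fun k j => y (k, j), fun k j => hy.1 _, I.mem_feasible_iff.2 hy.2, ?_, ?_⟩
    · ext j
      have := hyz (Sum.inr j)
      rwa [sum_splitMap_inr] at this
    · intro k hk
      have := hyz (Sum.inl k)
      rwa [sum_splitMap_inl, if_neg hk] at this
  · rintro ⟨y, hy, hwy, hyi, hyk⟩
    have h1 : Independent (contractBy I.edgeFn fun a => w a.1 a.2) fun a => y a.1 a.2 :=
      (independent_contractBy_iff hw').2 ⟨fun a => hy _ _, I.mem_feasible_iff.1 hwy⟩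
    have h2 := h1.aggregate (splitMap i)
    have h3 : (fun b => ∑ a with splitMap i a = b, y a.1 a.2) = Sum.elim z ζ := by
      ext (k | j)
      · rw [sum_splitMap_inl i k fun a => y a.1 a.2]
        split_ifs with hk
        · simp [hk, hz]
        · simp [hyk k hk]
      · rw [sum_splitMap_inr i j fun a => y a.1 a.2, ← hyi]
        rfl
    rwa [h3] at h2

/-- Lowering the edges of `i` to zero keeps feasibility, so one inclusion between the two sets of
futures is automatic; the other says that `ξ` fits next to every future of the others. -/
theorem mem_clinchPolytope_iff {w : Fin (n + m) → Fin m → ℝ} (hw : w ∈ I.feasible)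
    {d : Fin (n + m) → ℝ≥0∞} {i : Fin (n + m)} {ξ : Fin m → ℝ} :
    ξ ∈ I.clinchPolytope w d i ↔ (∀ j, 0 ≤ ξ j) ∧ ENNReal.ofReal (∑ j, ξ j) ≤ d i ∧
      ∀ z : Fin (n + m) → ℝ, z i = 0 → (∀ k, k ≠ i → ENNReal.ofReal (z k) ≤ d k) →
        Independent (I.splitFn w i) (Sum.elim z 0) → Independent (I.splitFn w i) (Sum.elim z ξ) := by
  constructor
  · rintro ⟨h0, -, heq⟩
    refine ⟨h0, ?_, fun z hzi hzd hz => ?_⟩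
    · have h1 : (0 : {k : Fin (n + m) // k ≠ i} → ℝ) ∈ I.othersAfter w d i 0 :=
        ⟨0, (I.mem_remnant_iff hw).2 ⟨by simp, by simpa using hw, by simp⟩, by simp, by simp⟩
      rw [← heq] at h1
      obtain ⟨y, hy, rfl, -⟩ := h1
      exact hy.2.2.2 i
    · obtain ⟨y, hy0, hwy, hyi, hyz⟩ := (I.independent_splitFn_iff hw hzi).1 hz
      have h1 : (fun k : {k : Fin (n + m) // k ≠ i} => z k) ∈ I.othersAfter w d i 0 := by
        refine ⟨y, (I.mem_remnant_iff hw).2 ⟨hy0, hwy, fun k => ?_⟩, hyi, fun k => hyz k k.2⟩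
        by_cases hk : k = i
        · subst hk
          simp [hyi]
        · rw [hyz k hk]
          exact hzd k hk
      rw [← heq] at h1
      obtain ⟨y', hy', hyi', hyz'⟩ := h1
      exact (I.independent_splitFn_iff hw hzi).2
        ⟨y', hy'.1, hy'.2.2.1, hyi', fun k hk => hyz' ⟨k, hk⟩⟩
  · rintro ⟨h0, hdi, h⟩
    have hP : I.othersAfter w d i ξ = I.othersAfter w d i 0 := by
      ext u
      constructor
      · rintro ⟨y, hy, hyi, hyu⟩
        have hle : ∀ k j, Function.update y i 0 k j ≤ y k j := by
          intro k j
          by_cases hk : k = i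
          · subst hk
            simpa using hy.1 k j
          · simp [hk]
        have hnn : ∀ k j, 0 ≤ Function.update y i 0 k j := by
          intro k j
          by_cases hk : k = i
          · subst hk
            simp
          · simpa [hk] using hy.1 k j
        refine ⟨Function.update y i 0, (I.mem_remnant_iff hw).2 ⟨hnn, ?_, fun k => ?_⟩, by simp,
          fun k => ?_⟩
        · rw [mem_feasible_iff]
          exact (I.mem_feasible_iff.1 hy.2.2.1).mono
            (fun a => add_nonneg (hw.1 _ _) (hnn _ _)) fun a => by
              simpa using hle a.1 a.2
        · exact (ENNReal.ofReal_le_ofReal (Finset.sum_le_sum fun j _ => hle k j)).trans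
            (hy.2.2.2 k)
        · simpa [k.2] using hyu k
      · rintro ⟨y, hy, hyi, hyu⟩
        have hz : Independent (I.splitFn w i)
            (Sum.elim (fun k => if k = i then 0 else ∑ j, y k j) 0) :=
          (I.independent_splitFn_iff hw (by simp)).2
            ⟨y, hy.1, hy.2.2.1, hyi, fun k hk => by simp [hk]⟩
        obtain ⟨y', hy0, hwy, hyi', hyz⟩ := (I.independent_splitFn_iff hw (by simp)).1
          (h _ (by simp) (fun k hk => by simpa [hk] using hy.2.2.2 k) hz)
        refine ⟨y', (I.mem_remnant_iff hw).2 ⟨hy0, hwy, fun k => ?_⟩, hyi', fun k => ?_⟩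
        · by_cases hk : k = i
          · subst hk
            rwa [hyi']
          · rw [hyz k hk, if_neg hk]
            exact hy.2.2.2 k
        · rw [hyz k k.2, if_neg k.2, hyu]
    refine ⟨h0, fun j hj => ?_, hP⟩
    have h1 : (0 : {k : Fin (n + m) // k ≠ i} → ℝ) ∈ I.othersAfter w d i 0 :=
      ⟨0, (I.mem_remnant_iff hw).2 ⟨by simp, by simpa using hw, by simp⟩, by simp, by simp⟩
    rw [← hP] at h1
    obtain ⟨y, hy, rfl, -⟩ := h1
    exact hy.2.1 i j hj

end Market

/-! ### Futures in terms of amounts, and saturated vectors. -/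

namespace Market

variable {n m : ℕ} (I : Market n m)

/-- The amount that buyer `k` obtains in the transactions `w`. -/
def amount (w : Fin (n + m) → Fin m → ℝ) (k : Fin (n + m)) : ℝ := ∑ j, w k j

/-- `z` is a vector of amounts that respects the demands `d` and extends the amounts obtained
so far to an independent vector. -/
structure Future (x : Fin (n + m) → ℝ) (d : Fin (n + m) → ℝ≥0∞) (z : Fin (n + m) → ℝ) :
    Prop where
  nonneg : ∀ k, 0 ≤ z k
  le : ∀ k, ENNReal.ofReal (z k) ≤ d k
  indep : Independent I.total fun k => x k + z k

/-- A future in which all goods are sold. -/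
def FullFuture (x : Fin (n + m) → ℝ) (d : Fin (n + m) → ℝ≥0∞) (z : Fin (n + m) → ℝ) : Prop :=
  I.Future x d z ∧ ∑ k, (x k + z k) = I.total Finset.univ

/-- Every future that is possible in view of the amounts obtained so far is realised by
transactions that extend the current ones, and all goods can be sold. -/
structure Consistent (w : Fin (n + m) → Fin m → ℝ) (d : Fin (n + m) → ℝ≥0∞) : Prop where
  feasible : w ∈ I.feasible
  lift : ∀ z, I.Future (amount w) d z → ∃ y ∈ I.remnant w d, ∀ k, amount y k = z k
  full : ∃ z, I.FullFuture (amount w) d z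

/-- The demand of buyer `k`, capped by a number that no amount of goods can reach. -/
noncomputable def cappedDemand (d : Fin (n + m) → ℝ≥0∞) (k : Fin (n + m)) : ℝ :=
  (min (d k) (ENNReal.ofReal (I.total Finset.univ + 1))).toReal

theorem ofReal_cappedDemand_le (d : Fin (n + m) → ℝ≥0∞) (k : Fin (n + m)) :
    ENNReal.ofReal (I.cappedDemand d k) ≤ d k := by
  rw [cappedDemand, ENNReal.ofReal_toReal (by simp)]
  exact min_le_left _ _

theorem cappedDemand_nonneg (d : Fin (n + m) → ℝ≥0∞) (k : Fin (n + m)) :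
    0 ≤ I.cappedDemand d k := ENNReal.toReal_nonneg

theorem le_cappedDemand {d : Fin (n + m) → ℝ≥0∞} {k : Fin (n + m)} {t : ℝ}
    (ht : t ≤ I.total Finset.univ) (hd : ENNReal.ofReal t ≤ d k) : t ≤ I.cappedDemand d k := by
  rw [cappedDemand, ← ENNReal.ofReal_le_iff_le_toReal (by simp)]
  exact le_min hd (ENNReal.ofReal_le_ofReal (by linarith))

theorem eq_ofReal_cappedDemand {d : Fin (n + m) → ℝ≥0∞} {k : Fin (n + m)}
    (h : I.cappedDemand d k ≤ I.total Finset.univ) :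
    d k = ENNReal.ofReal (I.cappedDemand d k) := by
  rw [cappedDemand, ENNReal.ofReal_toReal (by simp)]
  symm
  apply min_eq_left
  by_contra hcon
  have h0 := I.isPolymatroid_total.mono ∅ Finset.univ (by simp)
  rw [I.isPolymatroid_total.empty] at h0
  rw [cappedDemand, min_eq_right (le_of_not_ge hcon), ENNReal.toReal_ofReal (by linarith)] at h
  linarith

theorem le_total_univ {u : Fin (n + m) → ℝ} (hu : Independent I.total u) (k : Fin (n + m)) :
    u k ≤ I.total Finset.univ := by
  have := hu.2 {k}
  rw [Finset.sum_singleton] at this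
  exact this.trans (I.isPolymatroid_total.mono _ _ (by simp))

theorem amount_nonneg {w : Fin (n + m) → Fin m → ℝ} (hw : w ∈ I.feasible) (k : Fin (n + m)) :
    0 ≤ amount w k := Finset.sum_nonneg fun _ _ => hw.1 _ _

theorem Future.mono {I : Market n m} {x : Fin (n + m) → ℝ} {d : Fin (n + m) → ℝ≥0∞}
    {z z' : Fin (n + m) → ℝ} (hz : I.Future x d z) (hx : ∀ k, 0 ≤ x k) (h0 : ∀ k, 0 ≤ z' k)
    (h : ∀ k, z' k ≤ z k) : I.Future x d z' where
  nonneg := h0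
  le k := (ENNReal.ofReal_le_ofReal (h k)).trans (hz.le k)
  indep := hz.indep.mono (fun k => add_nonneg (hx k) (h0 k)) fun k => by linarith [h k]

variable {I}
variable {w : Fin (n + m) → Fin m → ℝ} {d : Fin (n + m) → ℝ≥0∞} {i : Fin (n + m)}
  {z : Fin (n + m) → ℝ} {ξ ζ : Fin m → ℝ}

theorem Future.le_total (hw : w ∈ I.feasible) (hz : I.Future (amount w) d z)
    (k : Fin (n + m)) : z k ≤ I.total Finset.univ := by
  have h1 := I.le_total_univ hz.indep k
  have h2 := I.amount_nonneg hw k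
  linarith

theorem independent_total_of_splitFn (hw : w ∈ I.feasible) (hz : z i = 0)
    (h : Independent (I.splitFn w i) (Sum.elim z ζ)) :
    Independent I.total fun k => amount w k + if k = i then ∑ j, ζ j else z k := by
  obtain ⟨y, hy, hwy, hyi, hyk⟩ := (I.independent_splitFn_iff hw hz).1 h
  have h1 := I.independent_total_of_mem_feasible hwy
  convert h1 using 2 with k
  split_ifs with hk
  · subst hk
    simp [amount, Finset.sum_add_distrib, hyi]
  · simp [amount, Finset.sum_add_distrib, hyk k hk]

theorem independent_splitFn_of_mem_remnant (hw : w ∈ I.feasible) {y : Fin (n + m) → Fin m → ℝ}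
    (hy : y ∈ I.remnant w d) (i : Fin (n + m)) :
    Independent (I.splitFn w i) (Sum.elim (fun k => if k = i then 0 else amount y k) (y i)) :=
  (I.independent_splitFn_iff hw (by simp)).2
    ⟨y, hy.1, hy.2.2.1, rfl, fun k hk => by simp [hk, amount]⟩

theorem independent_splitFn_zero (h : Independent (I.splitFn w i) (Sum.elim z ζ)) :
    Independent (I.splitFn w i) (Sum.elim z 0) := by
  refine h.mono ?_ ?_
  · rintro (k | j)
    · exact h.1 (Sum.inl k)
    · simp
  · rintro (k | j)
    · simp
    · simpa using h.1 (Sum.inr j)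

/-- There is a vector of amounts of the buyers other than `i` that cannot be increased. -/
theorem exists_saturated (hw : w ∈ I.feasible) (d : Fin (n + m) → ℝ≥0∞) (i : Fin (n + m)) :
    ∃ (z : Fin (n + m) → ℝ) (T : Finset (Fin (n + m) ⊕ Fin m)), z i = 0 ∧
      (∀ k, k ≠ i → z k ≤ I.cappedDemand d k) ∧ Independent (I.splitFn w i) (Sum.elim z 0) ∧
      ∑ b ∈ T, Sum.elim z 0 b = I.splitFn w i T ∧
      ∀ k, k ≠ i → Sum.inl k ∉ T → z k = I.cappedDemand d k := by
  have hR := I.isPolymatroid_splitFn hw i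
  have h0 : Independent (I.splitFn w i) 0 := by
    refine ⟨by simp, fun S => ?_⟩
    have := hR.mono ∅ S (by simp)
    rw [hR.empty] at this
    simpa using this
  obtain ⟨u, T, hu, -, huB, hcap, hT, hsat⟩ := exists_augment hR h0
    (Sum.elim (I.cappedDemand d) 0) ((Finset.univ.erase i).map Function.Embedding.inl)
    (by simp [cappedDemand_nonneg])
  have hu0 : u = Sum.elim (fun k => u (Sum.inl k)) 0 := by
    ext (k | j)
    · rfl
    · rw [huB _ (by simp)]
      rfl
  rw [hu0] at hu hT
  refine ⟨fun k => u (Sum.inl k), T, huB _ (by simp), fun k hk => ?_, hu, hT, fun k hk hkT => ?_⟩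
  · exact hcap (Sum.inl k) (by simp [hk])
  · exact hsat (Sum.inl k) (by simp [hk]) hkT

/-- What buyer `i` can get next to a saturated vector of the other buyers, she can get next to
any vector. -/
theorem independent_splitFn_of_saturated (hw : w ∈ I.feasible)
    {T : Finset (Fin (n + m) ⊕ Fin m)} (hzi : z i = 0)
    (hT : ∑ b ∈ T, Sum.elim z 0 b = I.splitFn w i T)
    (hsat : ∀ k, k ≠ i → Sum.inl k ∉ T → z k = I.cappedDemand d k)
    (hξ : Independent (I.splitFn w i) (Sum.elim z ξ)) {z' : Fin (n + m) → ℝ} (hzi' : z' i = 0)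
    (hd : ∀ k, k ≠ i → z' k ≤ I.cappedDemand d k)
    (hz' : Independent (I.splitFn w i) (Sum.elim z' 0)) :
    Independent (I.splitFn w i) (Sum.elim z' ξ) := by
  refine ⟨?_, fun Q => ?_⟩
  · rintro (k | j)
    · exact hz'.1 (Sum.inl k)
    · exact hξ.1 (Sum.inr j)
  -- Uncross `Q` with the tight set `T`: off `T` the vector `z` is at the caps and dominates `z'`,
  -- and `ξ` has no more mass on `Q ∩ T` than on `T`.
  · have h1 := (I.isPolymatroid_splitFn hw i).submod Q T
    have h2 := hξ.2 (Q ∪ T)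
    have h3 := hz'.2 (Q ∩ T)
    have a0 : ∑ b ∈ Q ∪ T, Sum.elim z ξ b =
        ∑ b ∈ Q \ T, Sum.elim z ξ b + ∑ b ∈ T, Sum.elim z ξ b := by
      rw [← Finset.union_sdiff_right, Finset.sum_sdiff Finset.subset_union_right]
    have a0' : ∑ b ∈ Q, Sum.elim z' ξ b =
        ∑ b ∈ Q ∩ T, Sum.elim z' ξ b + ∑ b ∈ Q \ T, Sum.elim z' ξ b := by
      rw [Finset.sum_inter_add_sum_sdiff]
    have a1 : ∑ b ∈ Q \ T, Sum.elim z' ξ b ≤ ∑ b ∈ Q \ T, Sum.elim z ξ b := by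
      refine Finset.sum_le_sum ?_
      rintro (k | j) hb
      · by_cases hk : k = i
        · simp [hk, hzi, hzi']
        · simpa [hsat k hk (Finset.mem_sdiff.1 hb).2] using hd k hk
      · simp
    have a2 : ∑ b ∈ Q ∩ T, Sum.elim z' ξ b - ∑ b ∈ Q ∩ T, Sum.elim z' 0 b =
        ∑ b ∈ Q ∩ T, Sum.elim (0 : Fin (n + m) → ℝ) ξ b := by
      rw [← Finset.sum_sub_distrib]
      refine Finset.sum_congr rfl ?_
      rintro (k | j) _ <;> simp
    have a3 : ∑ b ∈ T, Sum.elim z ξ b - ∑ b ∈ T, Sum.elim z 0 b =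
        ∑ b ∈ T, Sum.elim (0 : Fin (n + m) → ℝ) ξ b := by
      rw [← Finset.sum_sub_distrib]
      refine Finset.sum_congr rfl ?_
      rintro (k | j) _ <;> simp
    have a4 : ∑ b ∈ Q ∩ T, Sum.elim (0 : Fin (n + m) → ℝ) ξ b ≤
        ∑ b ∈ T, Sum.elim (0 : Fin (n + m) → ℝ) ξ b := by
      refine Finset.sum_le_sum_of_subset_of_nonneg Finset.inter_subset_right ?_
      rintro (k | j) _ _
      · simp
      · exact hξ.1 (Sum.inr j)
    linarith

/-- The amounts on the edges of buyer `i` can be increased until all her edges are tight. -/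
theorem exists_row_saturated (hw : w ∈ I.feasible)
    (hξ : Independent (I.splitFn w i) (Sum.elim z ξ)) :
    ∃ (ζ : Fin m → ℝ) (T : Finset (Fin (n + m) ⊕ Fin m)), (∀ j, ξ j ≤ ζ j) ∧
      Independent (I.splitFn w i) (Sum.elim z ζ) ∧ (∀ j, Sum.inr j ∈ T) ∧
      ∑ b ∈ T, Sum.elim z ζ b = I.splitFn w i T := by
  have hR := I.isPolymatroid_splitFn hw i
  have hle : ∀ u, Independent (I.splitFn w i) u → ∀ b, u b ≤ I.splitFn w i Finset.univ := by
    intro u hu b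
    have := hu.2 {b}
    rw [Finset.sum_singleton] at this
    exact this.trans (hR.mono _ _ (by simp))
  -- The cap exceeds the total rank and is never attained, so each edge of `i` ends in the tight
  -- set.
  obtain ⟨u, T, hu, hmono, huB, -, hT, hsat⟩ := exists_augment hR hξ
    (fun _ => I.splitFn w i Finset.univ + 1) (Finset.univ.map Function.Embedding.inr)
    fun b _ => by linarith [hle _ hξ b]
  have hu0 : Sum.elim z (fun j => u (Sum.inr j)) = u := by
    ext (k | j)
    · rw [huB _ (by simp)]
      rfl
    · rfl
  refine ⟨fun j => u (Sum.inr j), T, fun j => hmono (Sum.inr j), ?_, fun j => ?_, ?_⟩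
  · rwa [hu0]
  · by_contra hj
    have h1 := hsat (Sum.inr j) (by simp) hj
    have h2 := hle u hu (Sum.inr j)
    linarith
  · rwa [hu0]

end Market

/-! ### The clinching step. -/

namespace Market

variable {n m : ℕ} {I : Market n m} {w : Fin (n + m) → Fin m → ℝ} {d d' : Fin (n + m) → ℝ≥0∞}
  {i : Fin (n + m)} {z : Fin (n + m) → ℝ} {ξ ζ : Fin m → ℝ}

theorem sum_ite_eq_add {z : Fin (n + m) → ℝ} (hz : z i = 0) (t : ℝ) :
    ∑ k, (if k = i then t else z k) = t + ∑ k, z k := by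
  have h1 : ∀ k, (if k = i then t else z k) = (if k = i then t else 0) + z k := by
    intro k
    split_ifs with hk
    · simp [hk, hz]
    · simp
  simp [h1, Finset.sum_add_distrib]

theorem sum_ite_zero (z : Fin (n + m) → ℝ) (i : Fin (n + m)) :
    ∑ k, (if k = i then 0 else z k) = ∑ k, z k - z i := by
  have h1 : ∀ k, (if k = i then 0 else z k) = z k - if k = i then z k else 0 := by
    intro k
    split_ifs <;> simp
  simp [h1, Finset.sum_sub_distrib]

theorem le_cappedDemand_of_splitFn (hw : w ∈ I.feasible) (hz : z i = 0)
    (h : Independent (I.splitFn w i) (Sum.elim z ζ)) {k : Fin (n + m)} (hk : k ≠ i)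
    (hd : ENNReal.ofReal (z k) ≤ d k) : z k ≤ I.cappedDemand d k := by
  refine I.le_cappedDemand ?_ hd
  have h1 := I.le_total_univ (independent_total_of_splitFn hw hz h) k
  have h2 := I.amount_nonneg hw k
  simp only [hk, if_false] at h1
  linarith

/-- After buyer `i` has clinched a maximal vector, the others can take all remaining goods. -/
theorem Consistent.exists_full_of_maximal (h : I.Consistent w d)
    (hξ : Maximal (· ∈ I.clinchPolytope w d i) ξ) :
    ∃ z : Fin (n + m) → ℝ, z i = 0 ∧ (∀ k, k ≠ i → ENNReal.ofReal (z k) ≤ d k) ∧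
      Independent (I.splitFn w i) (Sum.elim z ξ) ∧
      ∑ k, amount w k + (∑ k, z k + ∑ j, ξ j) = I.total Finset.univ := by
  have hw := h.feasible
  have hmem := (I.mem_clinchPolytope_iff hw).1 hξ.prop
  obtain ⟨z, T, hzi, hzd, hz, hT, hsat⟩ := exists_saturated hw d i
  have hzd' : ∀ k, k ≠ i → ENNReal.ofReal (z k) ≤ d k := fun k hk =>
    (ENNReal.ofReal_le_ofReal (hzd k hk)).trans (I.ofReal_cappedDemand_le d k)
  have hzξ := hmem.2.2 z hzi hzd' hz
  obtain ⟨ζ, T', hξζ, hzζ, hT'mem, hT'⟩ := exists_row_saturated hw hzξ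
  have hζ0 : ∀ j, 0 ≤ ζ j := fun j => hzζ.1 (Sum.inr j)
  have hTζ : ∑ b ∈ T, Sum.elim z ζ b = I.splitFn w i T := by
    refine le_antisymm (hzζ.2 T) (hT.symm.le.trans (Finset.sum_le_sum ?_))
    rintro (k | j) _
    · simp
    · simpa using hζ0 j
  have hTT := tight_union (I.isPolymatroid_splitFn hw i) hzζ hTζ hT'
  -- A future `zf` that sells everything is compared with `z` twice. Together with the edges ζ of
  -- `i`, `z` sells at least as much; and the others alone get at least as much from `z` as from
  -- `zf`. Hence `z` with ζ sells everything, and ζ has total at most `zf i`.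
  obtain ⟨zf, hzf, hzfull⟩ := h.full
  obtain ⟨y, hy, hyz⟩ := h.lift zf hzf
  have hyI := independent_splitFn_of_mem_remnant hw hy i
  have hle : ∀ k, k ≠ i → amount y k ≤ I.cappedDemand d k := fun k hk => by
    rw [hyz]
    exact I.le_cappedDemand (hzf.le_total hw k) (hzf.le k)
  have h1 := hyI.sum_le_of_tight hTT (by
    rintro (k | j) hb
    · by_cases hk : k = i
      · simp [hk, hzi]
      · have := hsat k hk fun hkT => hb (Finset.mem_union_left _ hkT)
        simpa [hk, this] using hle k hk
    · exact absurd (Finset.mem_union_right _ (hT'mem j)) hb)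
  have h2 := (independent_splitFn_zero hyI).sum_le_of_tight hT (by
    rintro (k | j) hb
    · by_cases hk : k = i
      · simp [hk, hzi]
      · have := hsat k hk hb
        simpa [hk, this] using hle k hk
    · simp)
  have h3 := (independent_total_of_splitFn hw hzi hzζ).2 Finset.univ
  simp only [Fintype.sum_sum_type, Sum.elim_inl, Sum.elim_inr, sum_ite_zero, Pi.zero_apply,
    Finset.sum_const_zero, Finset.sum_add_distrib, sum_ite_eq_add hzi] at h1 h2 h3 hzfull
  have h4 : ∑ j, y i j = amount y i := rfl
  have h5 : ∑ k, amount y k = ∑ k, zf k := Finset.sum_congr rfl fun k _ => hyz k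
  have h6 : amount y i = zf i := hyz i
  -- What fits next to the saturated `z` fits next to any future, so ζ can be clinched, and
  -- maximality of `ξ` gives ζ = ξ.
  have hmemζ : ζ ∈ I.clinchPolytope w d i := by
    refine (I.mem_clinchPolytope_iff hw).2 ⟨hζ0, ?_, fun z' hz'i hz'd hz' => ?_⟩
    · exact (ENNReal.ofReal_le_ofReal (by linarith)).trans (hzf.le i)
    · exact independent_splitFn_of_saturated hw hzi hT hsat hzζ hz'i
        (fun k hk => le_cappedDemand_of_splitFn hw hz'i hz' hk (hz'd k hk)) hz'
  have hζξ : ζ = ξ := le_antisymm (hξ.2 hmemζ hξζ) hξζ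
  subst hζξ
  exact ⟨z, hzi, hzd', hzξ, by linarith⟩

theorem amount_update (w : Fin (n + m) → Fin m → ℝ) (i : Fin (n + m)) (ξ : Fin m → ℝ)
    (k : Fin (n + m)) : amount (Function.update w i (w i + ξ)) k =
      amount w k + if k = i then ∑ j, ξ j else 0 := by
  by_cases hk : k = i
  · subst hk
    simp [amount, Finset.sum_add_distrib]
  · simp [amount, hk]

/-- A clinched vector fits next to the zero future of the others. -/
theorem Consistent.feasible_update (h : I.Consistent w d) (hξ : ξ ∈ I.clinchPolytope w d i) :
    Function.update w i (w i + ξ) ∈ I.feasible := by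
  have hmem := (I.mem_clinchPolytope_iff h.feasible).1 hξ
  have h0 : Independent (I.splitFn w i) (Sum.elim (0 : Fin (n + m) → ℝ) (0 : Fin m → ℝ)) :=
    (I.independent_splitFn_iff h.feasible rfl).2
      ⟨0, by simp, by simpa using h.feasible, rfl, by simp⟩
  obtain ⟨y, hy, hwy, hyi, hyk⟩ := (I.independent_splitFn_iff h.feasible rfl).1
    (hmem.2.2 0 rfl (by simp) h0)
  convert hwy using 1
  ext k j
  by_cases hk : k = i
  · subst hk
    simp [hyi]
  · have := (Finset.sum_eq_zero_iff_of_nonneg fun j _ => hy k j).1 (hyk k hk) j (Finset.mem_univ j)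
    simp [hk, this]

/-- A realisation of `z` plus the clinched amount exists before the step, but its row `i` need not
dominate `ξ`. Keeping the totals of the others, the row is replaced by one above `ξ`: extending `ξ`
to a saturated row yields at least the required total, and interpolation hits it. -/
theorem Consistent.lift_update (h : I.Consistent w d) (hξ : ξ ∈ I.clinchPolytope w d i)
    (hd : ∀ k, k ≠ i → d' k = d k) (hdi : d' i + ENNReal.ofReal (∑ j, ξ j) ≤ d i)
    {z : Fin (n + m) → ℝ}
    (hz : I.Future (amount (Function.update w i (w i + ξ))) d' z) :
    ∃ y ∈ I.remnant (Function.update w i (w i + ξ)) d', ∀ k, amount y k = z k := by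
  have hw := h.feasible
  have hw' := h.feasible_update hξ
  have hmem := (I.mem_clinchPolytope_iff hw).1 hξ
  have hδ : 0 ≤ ∑ j, ξ j := Finset.sum_nonneg fun j _ => hmem.1 j
  obtain ⟨y, hy, hyz⟩ := h.lift (fun k => z k + if k = i then ∑ j, ξ j else 0)
    ⟨fun k => add_nonneg (hz.nonneg k) (by split_ifs <;> simp [hδ]), fun k => by
      by_cases hk : k = i
      · subst hk
        rw [if_pos rfl, ENNReal.ofReal_add (hz.nonneg _) hδ]
        exact (add_le_add_left (hz.le _) _).trans hdi
      · simpa [hk] using (hz.le k).trans_eq (hd k hk), by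
      have := hz.indep
      simp only [amount_update] at this
      convert this using 2 with k
      ring⟩
  have hyI := independent_splitFn_of_mem_remnant hw hy i
  have hyξ := hmem.2.2 _ (by simp) (fun k hk => by simpa [hk, amount] using hy.2.2.2 k)
    (independent_splitFn_zero hyI)
  obtain ⟨ζ, T, hξζ, hζ, hTmem, hT⟩ := exists_row_saturated hw hyξ
  have h1 := hyI.sum_le_of_tight hT (by
    rintro (k | j) hb
    · simp
    · exact absurd (hTmem j) hb)
  simp only [Fintype.sum_sum_type, Sum.elim_inl, Sum.elim_inr, add_le_add_iff_left] at h1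
  have h2 : ∑ j, y i j = z i + ∑ j, ξ j := by
    have := hyz i
    rwa [if_pos rfl] at this
  -- a vector between `ξ` and `ζ` with the required sum
  set t := z i / (∑ j, ζ j - ∑ j, ξ j) with ht
  have ht0 : 0 ≤ t := div_nonneg (hz.nonneg i) (by linarith [hz.nonneg i])
  have ht1 : t ≤ 1 := div_le_one_of_le₀ (by linarith) (by linarith [hz.nonneg i])
  have hts : t * (∑ j, ζ j - ∑ j, ξ j) = z i := by
    -- If the two totals agree, then `z i = 0`, and the convention t = 0 for division by zero is the
    -- right one.
    by_cases h0 : ∑ j, ζ j - ∑ j, ξ j = 0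
    · rw [h0, mul_zero]
      linarith [hz.nonneg i]
    · exact div_mul_cancel₀ _ h0
  have hη0 : ∀ j, 0 ≤ t * (ζ j - ξ j) := fun j => mul_nonneg ht0 (by linarith [hξζ j])
  have hη1 : ∀ j, ξ j + t * (ζ j - ξ j) ≤ ζ j := fun j => by
    have := mul_le_mul_of_nonneg_right ht1 (sub_nonneg.2 (hξζ j))
    linarith
  have hη : Independent (I.splitFn w i) (Sum.elim (fun k => if k = i then 0 else amount y k)
      fun j => ξ j + t * (ζ j - ξ j)) := by
    refine hζ.mono ?_ ?_
    · rintro (k | j)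
      · exact hζ.1 (Sum.inl k)
      · exact add_nonneg (hmem.1 j) (hη0 j)
    · rintro (k | j)
      · simp
      · exact hη1 j
  obtain ⟨y', hy', hwy', hy'i, hy'k⟩ := (I.independent_splitFn_iff hw (by simp)).1 hη
  have hamount : ∀ k, amount (Function.update y' i fun j => t * (ζ j - ξ j)) k = z k := by
    intro k
    by_cases hk : k = i
    · subst hk
      simp [amount, ← Finset.mul_sum, hts]
    · have h3 := hy'k k hk
      rw [if_neg hk, hyz k, if_neg hk, add_zero] at h3
      simpa [amount, hk] using h3
  refine ⟨Function.update y' i fun j => t * (ζ j - ξ j),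
    (I.mem_remnant_iff hw').2 ⟨?_, ?_, ?_⟩, hamount⟩
  · intro k j
    by_cases hk : k = i
    · subst hk
      simpa using hη0 j
    · simpa [hk] using hy' k j
  · convert hwy' using 1
    ext k j
    by_cases hk : k = i
    · subst hk
      simp [hy'i]
      ring
    · simp [hk]
  · intro k
    have := hamount k
    rw [amount] at this
    rw [this]
    exact hz.le k

/-- The situation after a clinching step of buyer `i`. -/
theorem Consistent.clinch (h : I.Consistent w d) (hξ : Maximal (· ∈ I.clinchPolytope w d i) ξ)
    (hd : ∀ k, k ≠ i → d' k = d k) (hdi : d' i + ENNReal.ofReal (∑ j, ξ j) ≤ d i) :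
    I.Consistent (Function.update w i (w i + ξ)) d' ∧
      ∃ z, z i = 0 ∧ I.FullFuture (amount (Function.update w i (w i + ξ))) d' z := by
  have hfull : ∃ z, z i = 0 ∧ I.FullFuture (amount (Function.update w i (w i + ξ))) d' z := by
    obtain ⟨z, hzi, hzd, hz, hsum⟩ := h.exists_full_of_maximal hξ
    have h1 := independent_total_of_splitFn h.feasible hzi hz
    refine ⟨z, hzi, ⟨fun k => hz.1 (Sum.inl k), fun k => ?_, ?_⟩, ?_⟩
    · by_cases hk : k = i
      · simp [hk, hzi]
      · rw [hd k hk]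
        exact hzd k hk
    · convert h1 using 2 with k
      rw [amount_update]
      by_cases hk : k = i
      · simp [hk, hzi]
      · simp [hk]
    · simp only [amount_update, Finset.sum_add_distrib, Finset.sum_ite_eq', Finset.mem_univ,
        if_true]
      linarith
  refine ⟨⟨h.feasible_update hξ.prop, fun z hz => h.lift_update hξ.prop hd hdi hz, ?_⟩, hfull⟩
  obtain ⟨z, -, hz⟩ := hfull
  exact ⟨z, hz⟩

/-- Next to any vector of the other buyers, buyer `i` can get what she clinches. -/
theorem Consistent.independent_add_clinch (h : I.Consistent w d)
    (hξ : ξ ∈ I.clinchPolytope w d i) (hz : I.Future (amount w) d z) :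
    Independent I.total fun k => amount w k + if k = i then ∑ j, ξ j else z k := by
  obtain ⟨y, hy, hyz⟩ := h.lift z hz
  have hyI := independent_splitFn_of_mem_remnant h.feasible hy i
  have h1 := ((I.mem_clinchPolytope_iff h.feasible).1 hξ).2.2 _ (by simp)
    (fun k hk => by simpa [hk, amount] using hy.2.2.2 k) (independent_splitFn_zero hyI)
  have h2 := independent_total_of_splitFn h.feasible (by simp) h1
  convert h2 using 2 with k
  by_cases hk : k = i
  · simp [hk]
  · simp [hk, hyz]

/-- The clinching step of buyer `i` does not affect the property that all goods can be sold
without buyer `k`. -/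
theorem Consistent.fullFuture_clinch (h : I.Consistent w d) (hξ : ξ ∈ I.clinchPolytope w d i)
    (hd : ∀ k, k ≠ i → d' k = d k)
    (hdi : ∀ t, 0 ≤ t → ENNReal.ofReal (t + ∑ j, ξ j) ≤ d i → ENNReal.ofReal t ≤ d' i)
    {k : Fin (n + m)} (hk : k ≠ i)
    (hz : ∃ z, z k = 0 ∧ I.FullFuture (amount w) d z) :
    ∃ z, z k = 0 ∧ I.FullFuture (amount (Function.update w i (w i + ξ))) d' z := by
  obtain ⟨z, hzk, hz, hsum⟩ := hz
  have hx := I.amount_nonneg h.feasible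
  have h1 := (h.independent_add_clinch hξ (z := fun k => if k = i then 0 else z k)
    (hz.mono hx (fun k => by split_ifs <;> simp [hz.nonneg])
      fun k => by split_ifs with h <;> simp [hz.nonneg])).2 Finset.univ
  have h2 : ∀ k, (if k = i then ∑ j, ξ j else if k = i then 0 else z k) =
      (if k = i then ∑ j, ξ j else 0) + if k = i then 0 else z k := by
    intro k
    split_ifs <;> simp
  simp only [h2, Finset.sum_add_distrib, sum_ite_zero, Finset.sum_ite_eq', Finset.mem_univ,
    if_true] at h1 hsum
  -- What `i` clinches fits next to `z` without her part. Since `z` sells everything, her part was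
  -- at least that large, and the clinched amount can be subtracted from it.
  have hle : ∑ j, ξ j ≤ z i := by linarith
  refine ⟨fun k => z k - if k = i then ∑ j, ξ j else 0, by simp [hk, hzk], ⟨?_, ?_, ?_⟩, ?_⟩
  · intro k
    by_cases hk : k = i
    · simp [hk, hle]
    · simp [hk, hz.nonneg k]
  · intro k
    by_cases hk : k = i
    · subst hk
      simp only [if_true]
      exact hdi _ (by linarith) (by simpa using hz.le k)
    · simpa [hk, hd k hk] using hz.le k
  · convert hz.indep using 2 with k
    rw [amount_update]
    ring
  · simp only [amount_update, Finset.sum_add_distrib, Finset.sum_sub_distrib]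
    linarith

/-- If buyer `i` clinches a positive amount, there is a set of buyers without her that can take
its full share, and everybody else is saturated. -/
theorem Consistent.exists_tight_of_clinch (h : I.Consistent w d)
    (hξ : Maximal (· ∈ I.clinchPolytope w d i) ξ) (hpos : 0 < ∑ j, ξ j) :
    ∃ (T : Finset (Fin (n + m))) (z : Fin (n + m) → ℝ), i ∉ T ∧ (∀ k, 0 ≤ z k) ∧
      (∀ k, k ∉ T → k ≠ i → d k = ENNReal.ofReal (z k)) ∧
      I.total Finset.univ = I.total T + (amount w i + ∑ j, ξ j) +
        ∑ k ∈ Tᶜ.erase i, (amount w k + z k) := by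
  have hw := h.feasible
  obtain ⟨z₀, hz₀i, hz₀d, hz₀, hsum⟩ := h.exists_full_of_maximal hξ
  have hx := I.amount_nonneg hw
  have hz₀tot := independent_total_of_splitFn hw hz₀i (independent_splitFn_zero hz₀)
  simp only [Pi.zero_apply, Finset.sum_const_zero] at hz₀tot
  -- Starting from a future that with the clinched goods sells everything, the other buyers are
  -- filled up to their demands while `i` keeps her present amount.
  obtain ⟨u, T, hu, hmono, huB, hcap, hT, hsat⟩ := exists_augment I.isPolymatroid_total hz₀tot
    (fun k => amount w k + I.cappedDemand d k) (Finset.univ.erase i) (by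
      intro k hk
      have hk := Finset.ne_of_mem_erase hk
      simpa [hk] using le_cappedDemand_of_splitFn hw hz₀i hz₀ hk (hz₀d k hk))
  have hui : u i = amount w i := by simpa using huB i (by simp)
  have hle : ∀ k, amount w k ≤ u k := fun k => by
    refine le_trans ?_ (hmono k)
    have : 0 ≤ z₀ k := hz₀.1 (Sum.inl k)
    split_ifs <;> linarith
  have hfut : I.Future (amount w) d fun k => u k - amount w k := by
    refine ⟨fun k => by linarith [hle k], fun k => ?_, by simpa using hu⟩
    by_cases hk : k = i
    · simp [hk, hui]
    · refine (ENNReal.ofReal_le_ofReal ?_).trans (I.ofReal_cappedDemand_le d k)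
      linarith [hcap k (by simp [hk])]
  have h1 := (h.independent_add_clinch hξ.prop hfut).2 Finset.univ
  rw [Finset.sum_add_distrib, sum_ite_eq_add (by simp [hui]), Finset.sum_sub_distrib] at h1
  have h2 : ∑ k, amount w k + ∑ k, z₀ k ≤ ∑ k, u k := by
    rw [← Finset.sum_add_distrib]
    refine Finset.sum_le_sum fun k _ => (le_of_eq ?_).trans (hmono k)
    by_cases hk : k = i
    · simp [hk, hz₀i]
    · simp [hk]
  -- If `i` were in `T`, then `u` would already use all goods, leaving no room for the positive
  -- clinched amount.
  have hiT : i ∉ T := by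
    intro hi
    obtain ⟨zf, hzf, hzfull⟩ := h.full
    have := hzf.indep.sum_le_of_tight hT (by
      intro k hk
      have hki : k ≠ i := fun hki => hk (hki ▸ hi)
      rw [hsat k (by simp [hki]) hk]
      have := I.le_cappedDemand (hzf.le_total hw k) (hzf.le k)
      linarith)
    linarith
  have hz : ∀ k, k ∉ T → k ≠ i → u k = amount w k + I.cappedDemand d k :=
    fun k hk hki => hsat k (by simp [hki]) hk
  refine ⟨T, I.cappedDemand d, hiT, I.cappedDemand_nonneg d, fun k hk hki => ?_, ?_⟩
  · refine I.eq_ofReal_cappedDemand ?_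
    have h3 := hz k hk hki
    have h4 := I.le_total_univ hu k
    linarith [hx k]
  · have h3 : ∑ k ∈ Tᶜ.erase i, (amount w k + I.cappedDemand d k) = ∑ k ∈ Tᶜ.erase i, u k := by
      refine Finset.sum_congr rfl fun k hk => ?_
      rw [Finset.mem_erase, Finset.mem_compl] at hk
      exact (hz k hk.2 hk.1).symm
    have h4 := Finset.add_sum_erase Tᶜ u (Finset.mem_compl.2 hiT)
    have h5 := Finset.sum_add_sum_compl T u
    rw [h3]
    linarith

end Market

/-! ### The initial state, demands, and properties of the greedy allocation. -/

namespace Market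

variable {n m : ℕ} {I : Market n m}

theorem total_eq_total_univ {T : Finset (Fin (n + m))} (hT : ∀ j, Fin.natAdd n j ∈ T) :
    I.total T = I.total Finset.univ := by
  refine Finset.sum_congr rfl fun j _ => ?_
  have hv : Fin.natAdd n j ∈ I.nbrs j := Finset.mem_insert_self _ _
  simp [sellerFn, hT j, hv]

theorem consistent_zero : I.Consistent 0 fun _ => ⊤ := by
  have hx : amount (0 : Fin (n + m) → Fin m → ℝ) = 0 := by
    ext k
    simp [amount]
  have hP := I.isPolymatroid_edgeFn
  have hT := I.isPolymatroid_total
  have h0 : (0 : Fin (n + m) → Fin m → ℝ) ∈ I.feasible := by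
    refine I.mem_feasible_iff.2 ⟨by simp, fun S => ?_⟩
    have := hP.mono ∅ S (by simp)
    rw [hP.empty] at this
    simpa using this
  refine ⟨h0, fun z hz => ?_, ?_⟩
  · have h1 := hz.indep
    simp only [hx, Pi.zero_apply, zero_add] at h1
    obtain ⟨y, hy, hyz⟩ := I.exists_mem_feasible h1
    exact ⟨y, (I.mem_remnant_iff h0).2 ⟨hy.1, by simpa using hy, by simp⟩, hyz⟩
  · have h1 : Independent I.total 0 := by
      refine ⟨by simp, fun S => ?_⟩
      have := hT.mono ∅ S (by simp)
      rw [hT.empty] at this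
      simpa using this
    have hC : I.total ∅ ≤ I.total Finset.univ := hT.mono _ _ (by simp)
    rw [hT.empty] at hC
    obtain ⟨u, T, hu, -, -, -, hTu, hsat⟩ := exists_augment hT h1
      (fun _ => I.total Finset.univ + 1) Finset.univ fun k _ => by simp; linarith
    have hTuniv : T = Finset.univ := by
      refine Finset.eq_univ_of_forall fun k => ?_
      by_contra hk
      have h2 := hsat k (Finset.mem_univ k) hk
      have h3 := I.le_total_univ hu k
      linarith
    rw [hTuniv] at hTu
    exact ⟨u, ⟨hu.1, by simp, by simpa [hx] using hu⟩, by simpa [hx] using hTu⟩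

/-- The future that sells everything without `l` survives any reduction of her demand. -/
theorem Consistent.lower_demand {w : Fin (n + m) → Fin m → ℝ} {d d' : Fin (n + m) → ℝ≥0∞}
    (h : I.Consistent w d) {l : Fin (n + m)} (hd : ∀ k, k ≠ l → d' k = d k) (hl : d' l ≤ d l)
    (hz : ∃ z, z l = 0 ∧ I.FullFuture (amount w) d z) : I.Consistent w d' := by
  have hle : ∀ k, d' k ≤ d k := fun k => by
    by_cases hk : k = l
    · exact hk ▸ hl
    · exact (hd k hk).le
  refine ⟨h.feasible, fun z hz => ?_, ?_⟩
  · obtain ⟨y, hy, hyz⟩ := h.lift z ⟨hz.nonneg, fun k => (hz.le k).trans (hle k), hz.indep⟩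
    refine ⟨y, (I.mem_remnant_iff h.feasible).2 ⟨hy.1, hy.2.2.1, fun k => ?_⟩, hyz⟩
    have := hyz k
    rw [amount] at this
    rw [this]
    exact hz.le k
  · obtain ⟨z, hzl, hz, hsum⟩ := hz
    refine ⟨z, ⟨hz.nonneg, fun k => ?_, hz.indep⟩, hsum⟩
    by_cases hk : k = l
    · simp [hk, hzl]
    · rw [hd k hk]
      exact hz.le k

/-! ### Demands -/

theorem demand_antitone {i : Fin (n + m)} {c c' p : ℝ} (h0 : 0 ≤ c) (h : c ≤ c') :
    I.demand i c' p ≤ I.demand i c p := by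
  unfold demand
  split_ifs with h1 h2 h3 h4 h5 h6 h7
  · exact le_rfl
  · exact absurd (le_antisymm (h2 ▸ h) h0) h4
  · linarith
  · exact le_top
  · exact ENNReal.div_le_div_left (ENNReal.ofReal_le_ofReal h) _
  · linarith
  all_goals simp

/-- Paying c per unit reduces the remaining budget by exactly what the clinched units cost, so
amount plus demand is invariant under clinching. This keeps certificates valid. -/
theorem demand_add_clinch {i : Fin (n + m)} {c p δ : ℝ} (hc : 0 ≤ c) (hp : 0 ≤ p) (hδ : 0 ≤ δ)
    (h : ENNReal.ofReal δ ≤ I.demand i c p) :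
    I.demand i c (p + c * δ) + ENNReal.ofReal δ = I.demand i c p := by
  unfold demand at *
  split_ifs at * with h1 h2
  · simp
  · have hc' : 0 < c := lt_of_le_of_ne hc (Ne.symm h2)
    have hC0 : ENNReal.ofReal c ≠ 0 := by simpa using hc'
    have hC1 : ENNReal.ofReal c ≠ ⊤ := ENNReal.ofReal_ne_top
    rw [ENNReal.le_div_iff_mul_le (Or.inl hC0) (Or.inl hC1)] at h
    rw [ENNReal.ofReal_add hp (mul_nonneg hc hδ), ENNReal.ofReal_mul hc, tsub_add_eq_tsub_tsub]
    have h3 : ENNReal.ofReal δ = ENNReal.ofReal c * ENNReal.ofReal δ / ENNReal.ofReal c := by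
      rw [mul_comm, ENNReal.mul_div_cancel_right hC0 hC1]
    conv_lhs => rw [h3]
    rw [ENNReal.div_add_div_same, ← h3, tsub_add_cancel_of_le (by rwa [mul_comm])]
  · simpa using h

theorem ofReal_pay_le {i : Fin (n + m)} {c p δ : ℝ} (hc : 0 ≤ c) (hp : 0 ≤ p) (hδ : 0 ≤ δ)
    (h : ENNReal.ofReal δ ≤ I.demand i c p) (hB : ENNReal.ofReal p ≤ I.budget i) :
    ENNReal.ofReal (p + c * δ) ≤ I.budget i := by
  unfold demand at h
  split_ifs at h with h1 h2
  · simpa [h2] using hB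
  · have hc' : 0 < c := lt_of_le_of_ne hc (Ne.symm h2)
    have hC0 : ENNReal.ofReal c ≠ 0 := by simpa using hc'
    rw [ENNReal.le_div_iff_mul_le (Or.inl hC0) (Or.inl ENNReal.ofReal_ne_top)] at h
    rw [ENNReal.ofReal_add hp (mul_nonneg hc hδ), ENNReal.ofReal_mul hc]
    calc _ ≤ ENNReal.ofReal p + (I.budget i - ENNReal.ofReal p) := by
          gcongr
          rwa [mul_comm]
      _ = _ := add_tsub_cancel_of_le hB
  · have : δ = 0 := le_antisymm (by simpa using h) hδ
    simpa [this] using hB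

theorem value_pos (i : Fin (n + m)) : 0 < I.value i := by
  refine Fin.addCases (fun i => ?_) (fun j => ?_) i
  · simpa [value] using I.v_pos i
  · simpa [value] using I.ρ_pos j

/-! ### The greedy allocation -/

theorem capByBudget_le (i : Fin (n + m)) (t : ℝ) : I.capByBudget i t ≤ t := by
  unfold capByBudget
  split_ifs
  · exact le_rfl
  · exact min_le_right _ _

theorem xOpt_le_of_subset_before {i : Fin (n + m)} {H : Finset (Fin (n + m))}
    (hH : H ⊆ I.before i) : I.xOpt i ≤ I.total (insert i H) - ∑ k ∈ H, I.xOpt k := by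
  rw [I.xOpt_eq i]
  exact (capByBudget_le _ _).trans
    (Finset.inf'_le (fun H => I.total (insert i H) - ∑ k ∈ H, I.xOpt k)
      (Finset.mem_powerset.2 hH))

theorem notMem_before (i : Fin (n + m)) : i ∉ I.before i := by simp [before]

/-- The last buyer of `S` in the greedy order has all others of `S` before her, so her defining
minimum includes the constraint of `S`. -/
theorem sum_xOpt_le_total (S : Finset (Fin (n + m))) : ∑ k ∈ S, I.xOpt k ≤ I.total S := by
  rcases S.eq_empty_or_nonempty with rfl | hS
  · simp [I.isPolymatroid_total.empty]
  · obtain ⟨i, hi, hmax⟩ := S.exists_max_image (fun i => (I.before i).card) hS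
    have hsub : S.erase i ⊆ I.before i := by
      intro k hk
      obtain ⟨hki, hkS⟩ := Finset.mem_erase.1 hk
      by_contra hkb
      have : i ∈ I.before k := by
        simp only [before, Finset.mem_filter, Finset.mem_univ, true_and, not_or, not_lt,
          not_and] at hkb ⊢
        rcases hkb.1.lt_or_eq with h | h
        · exact Or.inl h
        · exact Or.inr ⟨h.symm, lt_of_le_of_ne (hkb.2 h) hki⟩
      exact absurd (hmax k hkS) (not_le.2 (I.before_card_lt this))
    have h1 := xOpt_le_of_subset_before hsub
    rw [Finset.insert_erase hi] at h1
    have h2 := Finset.add_sum_erase S I.xOpt hi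
    linarith

theorem xOpt_nonneg (i : Fin (n + m)) : 0 ≤ I.xOpt i := by
  rw [I.xOpt_eq i]
  have h0 : 0 ≤ (I.before i).powerset.inf' ⟨∅, Finset.empty_mem_powerset _⟩
      fun H => I.total (insert i H) - ∑ k ∈ H, I.xOpt k := by
    refine Finset.le_inf' _ _ fun H _ => ?_
    have h1 := sum_xOpt_le_total (I := I) H
    have h2 := I.isPolymatroid_total.mono H (insert i H) (Finset.subset_insert _ _)
    linarith
  unfold capByBudget
  split_ifs
  · exact h0
  · exact le_min (div_nonneg ENNReal.toReal_nonneg (value_pos i).le) h0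

theorem independent_xOpt : Independent I.total I.xOpt := ⟨xOpt_nonneg, sum_xOpt_le_total⟩

theorem value_mul_xOpt_le {i : Fin (n + m)} (hB : I.budget i ≠ ⊤) :
    I.value i * I.xOpt i ≤ (I.budget i).toReal := by
  rw [I.xOpt_eq i, capByBudget, if_neg hB, mul_comm, ← le_div_iff₀ (value_pos i)]
  exact min_le_left _ _

/-- The greedy amount of a buyer equals her budget divided by her value, or she belongs to a tight
set of buyers that come first in the greedy order. -/
theorem xOpt_dichotomy (i : Fin (n + m)) :
    (I.budget i ≠ ⊤ ∧ I.value i * I.xOpt i = (I.budget i).toReal) ∨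
      ∃ U, i ∈ U ∧ U ⊆ insert i (I.before i) ∧ ∑ k ∈ U, I.xOpt k = I.total U := by
  obtain ⟨H, hH, hmin⟩ := Finset.exists_mem_eq_inf' (s := (I.before i).powerset)
    ⟨∅, Finset.empty_mem_powerset _⟩ fun H => I.total (insert i H) - ∑ k ∈ H, I.xOpt k
  have heq := I.xOpt_eq i
  rw [hmin] at heq
  have hH := Finset.mem_powerset.1 hH
  have htight : I.xOpt i = I.total (insert i H) - ∑ k ∈ H, I.xOpt k →
      ∃ U, i ∈ U ∧ U ⊆ insert i (I.before i) ∧ ∑ k ∈ U, I.xOpt k = I.total U := fun h =>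
    ⟨insert i H, Finset.mem_insert_self _ _, Finset.insert_subset_insert _ hH, by
      rw [Finset.sum_insert fun hi => notMem_before i (hH hi), h]
      ring⟩
  unfold capByBudget at heq
  split_ifs at heq with hB
  · exact Or.inr (htight heq)
  · rcases min_choice ((I.budget i).toReal / I.value i)
      (I.total (insert i H) - ∑ k ∈ H, I.xOpt k) with h | h <;> rw [h] at heq
    · refine Or.inl ⟨hB, ?_⟩
      rw [heq, mul_div_cancel₀ _ (value_pos i).ne']
    · exact Or.inr (htight heq)

/-- A buyer whose price is below her value demands at least her greedy amount. -/
theorem xOpt_le_add_demand {k : Fin (n + m)} {c p x z : ℝ} (hcv : c < I.value k) (hc : 0 ≤ c)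
    (hpx : p ≤ c * x) (hz0 : 0 ≤ z) (hp : 0 ≤ p) (hz : I.demand k c p = ENNReal.ofReal z) :
    I.xOpt k ≤ x + z := by
  unfold demand at hz
  rw [if_pos hcv] at hz
  split_ifs at hz with h0
  · exact absurd hz.symm ENNReal.ofReal_ne_top
  have hc' : 0 < c := lt_of_le_of_ne hc (Ne.symm h0)
  have hC0 : ENNReal.ofReal c ≠ 0 := by simpa using hc'
  by_cases hB : I.budget k = ⊤
  · rw [hB, ENNReal.top_sub ENNReal.ofReal_ne_top,
      ENNReal.top_div_of_ne_top ENNReal.ofReal_ne_top] at hz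
    exact absurd hz.symm ENNReal.ofReal_ne_top
  · replace hz := (ENNReal.eq_div_iff hC0 ENNReal.ofReal_ne_top).1 hz.symm
    rw [← ENNReal.ofReal_mul hc] at hz
    have h1 : I.budget k ≤ ENNReal.ofReal (c * z + p) := by
      rw [ENNReal.ofReal_add (mul_nonneg hc hz0) hp, hz]
      exact le_tsub_add
    -- The budget is at most c (x + z), since the payments so far are at most c x. It also bounds v
    -- x*, hence c x*; divide by c.
    have h2 := ENNReal.toReal_le_of_le_ofReal (by positivity) h1
    have h3 := value_mul_xOpt_le hB
    have h4 := mul_le_mul_of_nonneg_right hcv.le (xOpt_nonneg (I := I) k)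
    have h5 : c * I.xOpt k ≤ c * (x + z) := by nlinarith
    exact le_of_mul_le_mul_left h5 hc'

end Market

/-! ### Certificates and the invariant of the auction. -/

namespace Market

variable {n m : ℕ} {I : Market n m}

/-- A certificate for the fact that buyer `i` can obtain no more than the amount `y` unless the
buyers outside `T` buy less than `M`. Here `K k` is the value of buyer `k` in units of the price
increment; it stems from a moment when the price of `i` was `q` increments. -/
def Certificate (I : Market n m) (K : Fin (n + m) → ℕ) (s : AuctionState n m) (i : Fin (n + m))
    (a : ℕ) (y : ℝ) : Prop :=
  ∃ (q : ℕ) (T : Finset (Fin (n + m))) (M : Fin (n + m) → ℝ), q < a ∧ q < K i ∧ i ∉ T ∧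
    (∀ k, 0 ≤ M k) ∧
    (∀ k, k ∉ T → k ≠ i → ENNReal.ofReal (s.x k) + s.d k ≤ ENNReal.ofReal (M k)) ∧
    I.total Finset.univ = I.total T + y + ∑ k ∈ Tᶜ.erase i, M k ∧
    ∀ k, k ∉ T → k ≠ i → (q + 2 ≤ K k ∨ (q + 1 ≤ K k ∧ i < k)) → I.xOpt k ≤ M k

/-- A certificate refers to the current state only through upper bounds on amount plus demand, which
never grows. -/
theorem Certificate.mono {K : Fin (n + m) → ℕ} {s s' : AuctionState n m} {i : Fin (n + m)}
    {a : ℕ} {y : ℝ} (h : I.Certificate K s i a y)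
    (hs : ∀ k, ENNReal.ofReal (s'.x k) + s'.d k ≤ ENNReal.ofReal (s.x k) + s.d k) :
    I.Certificate K s' i a y := by
  obtain ⟨q, T, M, h1, h2, h3, h4, h5, h6⟩ := h
  exact ⟨q, T, M, h1, h2, h3, h4, fun k hk hki => (hs k).trans (h5 k hk hki), h6⟩

/-- `y i a` is the amount that buyer `i` has bought at prices below `a` increments. -/
structure History (I : Market n m) (K : Fin (n + m) → ℕ) (A b : ℕ) (ε : ℝ)
    (s : AuctionState n m) (y : Fin (n + m) → ℕ → ℝ) : Prop where
  zero : ∀ i, y i 0 = 0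
  nonneg : ∀ i a, 0 ≤ y i a
  le : ∀ i a, y i a ≤ s.x i
  all : ∀ i (a : ℕ), s.c i < a * ε → y i a = s.x i
  pay : ∀ i, s.p i = ε * ∑ a ∈ Finset.range A, (s.x i - y i (a + 1))
  real : ∀ (i : Fin n) a, a ≤ b → y (Fin.castAdd m i) a = 0
  cert : ∀ i a, 0 < y i a → I.Certificate K s i a (y i a)

/-- The invariant of the auction. -/
structure Invariant (I : Market n m) (K : Fin (n + m) → ℕ) (A b : ℕ) (ε : ℝ)
    (s : AuctionState n m) : Prop where
  consistent : I.Consistent s.w s.d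
  demand : ∀ i, s.d i = I.demand i (s.c i) (s.p i)
  turn : s.l < n + m
  clock : ∃ q : ℕ, ∀ k : Fin (n + m), s.c k = ((q + if (k : ℕ) < s.l then 1 else 0 : ℕ) : ℝ) * ε
  pay_nonneg : ∀ i, 0 ≤ s.p i
  pay_le : ∀ i, s.p i ≤ s.c i * s.x i
  budget : ∀ i, ENNReal.ofReal (s.p i) ≤ I.budget i
  history : ∃ y, I.History K A b ε s y

variable {K : Fin (n + m) → ℕ} {A b : ℕ} {ε : ℝ} {s s' : AuctionState n m}

theorem Invariant.x_nonneg (h : I.Invariant K A b ε s) (i : Fin (n + m)) : 0 ≤ s.x i :=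
  I.amount_nonneg h.consistent.feasible i

theorem Invariant.c_nonneg (h : I.Invariant K A b ε s) (hε : 0 < ε) (i : Fin (n + m)) :
    0 ≤ s.c i := by
  obtain ⟨q, hq⟩ := h.clock
  rw [hq]
  positivity

theorem invariant_initState (hn : 0 < n + m) :
    I.Invariant K A b ε (initState n m) where
  consistent := consistent_zero
  demand i := by simp [initState, Market.demand, value_pos]
  turn := hn
  clock := ⟨0, by simp [initState]⟩
  pay_nonneg _ := le_rfl
  pay_le _ := by simp [initState]
  budget _ := by simp [initState]
  history := ⟨fun _ _ => 0, by
    constructor <;> simp [initState, AuctionState.x]⟩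

theorem afterClinch_x (s : AuctionState n m) (i k : Fin (n + m)) (ξ : Fin m → ℝ) :
    (I.afterClinch s i ξ).x k = s.x k + if k = i then ∑ j, ξ j else 0 :=
  amount_update s.w i ξ k

/-- A buyer who clinches a positive amount leaves a certificate. -/
theorem Invariant.certificate_clinch (h : I.Invariant K A b ε s) (hε : 0 < ε)
    (hK : ∀ i, I.value i = K i * ε) {i : Fin (n + m)} {ξ : Fin m → ℝ}
    (hξ : Maximal (· ∈ I.clinchPolytope s.w s.d i) ξ) (hpos : 0 < ∑ j, ξ j) {q : ℕ}
    (hq : s.c i = q * ε) {a : ℕ} (ha : q < a) :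
    I.Certificate K s i a (s.x i + ∑ j, ξ j) ∧ q < K i ∧
      ((∃ i₀ : Fin n, i = Fin.castAdd m i₀) → ∃ j : Fin m, K (Fin.natAdd n j) ≤ q) := by
  obtain ⟨T, z, hiT, hz0, hz, htot⟩ := h.consistent.exists_tight_of_clinch hξ hpos
  have hmem := (I.mem_clinchPolytope_iff h.consistent.feasible).1 hξ.prop
  have hci : s.c i < I.value i := by
    by_contra hcon
    have h1 := hmem.2.1
    rw [h.demand, Market.demand, if_neg hcon] at h1
    have : ∑ j, ξ j ≤ 0 := by simpa using h1
    linarith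
  have hqK : q < K i := by
    rw [hK, hq] at hci
    exact_mod_cast lt_of_mul_lt_mul_right hci hε.le
  obtain ⟨q₀, hclock⟩ := h.clock
  have hqq : q = q₀ + if (i : ℕ) < s.l then 1 else 0 := by
    have := (hclock i).symm.trans hq
    exact_mod_cast (mul_right_cancel₀ hε.ne' this).symm
  have hlt : ∀ k q', s.c k = (q' : ℕ) * ε → q' < K k → s.c k < I.value k := by
    intro k q' h1 h2
    rw [h1, hK]
    exact mul_lt_mul_of_pos_right (by exact_mod_cast h2) hε
  refine ⟨⟨q, T, fun k => s.x k + z k, ha, hqK, hiT, fun k => add_nonneg (h.x_nonneg k) (hz0 k),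
    fun k hk hki => ?_, ?_, fun k hk hki hcond => ?_⟩, hqK, ?_⟩
  · rw [hz k hk hki, ENNReal.ofReal_add (h.x_nonneg k) (hz0 k)]
  · exact htot
  -- The clock of `k` shows at most q + 1 steps, and at most q if `k` comes after `i`, because
  -- clocks advance in the order of the numbers.
  · have hck : s.c k < I.value k := by
      refine hlt k _ (hclock k) ?_
      have : i < k ↔ (i : ℕ) < k := Iff.rfl
      split_ifs at hqq ⊢ <;> omega
    exact xOpt_le_add_demand hck (h.c_nonneg hε k) (h.pay_le k) (hz0 k) (h.pay_nonneg k)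
      ((h.demand k).symm.trans (hz k hk hki))
  · rintro ⟨i₀, rfl⟩
    by_contra! hcon
    -- Virtual buyers come after the real buyer, so their clocks show at most q steps, below their
    -- values; their demands are infinite, whereas those outside `T` are finite. Then `T` carries
    -- the full rank and nothing is left to clinch.
    have hT : ∀ j, Fin.natAdd n j ∈ T := by
      intro j
      by_contra hj
      have hne : Fin.natAdd n j ≠ Fin.castAdd m i₀ := by
        intro h1
        have := congrArg Fin.val h1
        simp at this
        omega
      have h1 := hz _ hj hne
      have h2 : s.c (Fin.natAdd n j) < I.value (Fin.natAdd n j) := by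
        refine hlt _ _ (hclock _) ((?_ : _ ≤ q).trans_lt (hcon j))
        rw [hqq]
        have : ((Fin.castAdd m i₀ : Fin (n + m)) : ℕ) < (Fin.natAdd n j : Fin (n + m)) := by
          simp
          omega
        split_ifs <;> omega
      have h3 : I.budget (Fin.natAdd n j) = ⊤ := by simp [Market.budget]
      rw [h.demand, Market.demand, if_pos h2, h3, ENNReal.top_sub ENNReal.ofReal_ne_top,
        ENNReal.top_div_of_ne_top ENNReal.ofReal_ne_top, ite_self] at h1
      exact ENNReal.ofReal_ne_top h1.symm
    rw [total_eq_total_univ hT] at htot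
    have h1 : 0 ≤ ∑ k ∈ Tᶜ.erase (Fin.castAdd m i₀), (amount s.w k + z k) :=
      Finset.sum_nonneg fun k _ => add_nonneg (h.x_nonneg k) (hz0 k)
    have h2 := h.x_nonneg (Fin.castAdd m i₀)
    have h3 : amount s.w (Fin.castAdd m i₀) = s.x (Fin.castAdd m i₀) := rfl
    linarith

theorem Invariant.history_clinch (h : I.Invariant K A b ε s) (hε : 0 < ε)
    (hK : ∀ i, I.value i = K i * ε) (hA : ∀ i, K i ≤ A) (hb : ∀ i, b ≤ K i) {i : Fin (n + m)}
    {ξ : Fin m → ℝ} (hξ : Maximal (· ∈ I.clinchPolytope s.w s.d i) ξ)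
    (hle : ∀ k, ENNReal.ofReal ((I.afterClinch s i ξ).x k) + (I.afterClinch s i ξ).d k ≤
      ENNReal.ofReal (s.x k) + s.d k) :
    ∃ y, I.History K A b ε (I.afterClinch s i ξ) y := by
  obtain ⟨y, hy⟩ := h.history
  obtain ⟨q₀, hclock⟩ := h.clock
  obtain ⟨q, hq⟩ : ∃ q : ℕ, s.c i = q * ε := ⟨_, hclock i⟩
  have hδ0 : 0 ≤ ∑ j, ξ j := Finset.sum_nonneg fun j _ => hξ.prop.1 j
  have hlt : ∀ a : ℕ, s.c i < a * ε ↔ q < a := fun a => by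
    rw [hq, mul_lt_mul_iff_left₀ hε, Nat.cast_lt]
  set δ := ∑ j, ξ j with hδ
  have hc : (I.afterClinch s i ξ).c = s.c := rfl
  -- Goods clinched at q steps count as bought below a steps exactly when q < a.
  refine ⟨fun k a => y k a + if k = i ∧ q < a then δ else 0,
    ⟨fun k => by simp [hy.zero], fun k a => ?_, fun k a => ?_, fun k a hka => ?_, fun k => ?_,
      fun i₀ a hab => ?_, fun k a hpos => ?_⟩⟩
  · exact add_nonneg (hy.nonneg k a) (by split_ifs <;> simp [hδ0])
  · rw [afterClinch_x]
    refine add_le_add (hy.le k a) ?_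
    by_cases hk : k = i <;> by_cases hqa : q < a <;> simp [hk, hqa, ← hδ, hδ0]
  · rw [hc] at hka
    rw [afterClinch_x, hy.all k a hka]
    by_cases hk : k = i
    · subst hk
      simp [(hlt a).1 hka, ← hδ]
    · simp [hk]
  · have hpay := hy.pay k
    by_cases hk : k = i
    · subst hk
      have h1 : (I.afterClinch s k ξ).p k = s.p k + s.c k * δ := by simp [afterClinch, hδ]
      rw [h1, hpay, afterClinch_x, hq]
      -- The new units enter the payment sum at the indices a < q, that is q times, which is their
      -- price in steps.
      have h2 : ∀ a, s.x k + (if k = k then δ else 0) -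
          (y k (a + 1) + if k = k ∧ q < a + 1 then δ else 0) =
          (s.x k - y k (a + 1)) + if a < q then δ else 0 := by
        intro a
        by_cases ha : a < q
        · simp [ha, Nat.not_lt.2 (Nat.succ_le_of_lt ha)]
          ring
        · simp [ha, Nat.lt_succ_of_le (Nat.le_of_not_lt ha)]
      change _ = ε * ∑ a ∈ Finset.range A, (s.x k + (if k = k then δ else 0) -
        (y k (a + 1) + if k = k ∧ q < a + 1 then δ else 0))
      rw [Finset.sum_congr rfl fun a _ => h2 a, Finset.sum_add_distrib]
      -- A positive amount is clinched only below the value, so q < `K k` ≤ A and the range contains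
      -- all q indices.
      rcases hδ0.eq_or_lt with h0 | hpos
      · simp [← h0]
      · have hqK := (h.certificate_clinch hε hK hξ hpos hq (Nat.lt_succ_self q)).2.1
        have h3 : (Finset.range A).filter (· < q) = Finset.range q := by
          ext a
          have := hA k
          simp only [Finset.mem_filter, Finset.mem_range]
          omega
        rw [← Finset.sum_filter, h3, Finset.sum_const, Finset.card_range, nsmul_eq_mul]
        ring
    · have h1 : (I.afterClinch s i ξ).p k = s.p k := by simp [afterClinch, hk]
      simp [h1, hpay, afterClinch_x, hk]
  · simp only [hy.real i₀ a hab, zero_add, ite_eq_right_iff, and_imp]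
    intro hi hqa
    by_contra hne
    obtain ⟨j, hj⟩ := (h.certificate_clinch hε hK hξ (lt_of_le_of_ne hδ0 (Ne.symm hne)) hq
      hqa).2.2 ⟨i₀, hi.symm⟩
    have := hb (Fin.natAdd n j)
    omega
  · rcases hδ0.eq_or_lt with h0 | hδpos
    · simp only [← h0, ite_self, add_zero] at hpos ⊢
      exact (hy.cert k a hpos).mono hle
    -- For q < a everything `i` has was bought below a steps, so the fresh certificate has the
    -- required amount; otherwise the old one is kept.
    · by_cases hk : k = i ∧ q < a
      · obtain ⟨rfl, hqa⟩ := hk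
        simp only [hqa, and_self, if_true]
        rw [hy.all k a ((hlt a).2 hqa)]
        exact (h.certificate_clinch hε hK hξ hδpos hq hqa).1.mono hle
      · simp only [hk, if_false, add_zero] at hpos ⊢
        exact (hy.cert k a hpos).mono hle

/-- All goods can be sold without buyer `k`. -/
def Dispensable (I : Market n m) (s : AuctionState n m) (k : Fin (n + m)) : Prop :=
  ∃ z, z k = 0 ∧ I.FullFuture (amount s.w) s.d z

/-- Besides preserving the invariant, a clinching step makes the clinching buyer dispensable by
maximality, and nobody ceases to be dispensable. After a round this holds for everyone. -/
theorem Invariant.clinchStep (h : I.Invariant K A b ε s) (hε : 0 < ε)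
    (hK : ∀ i, I.value i = K i * ε) (hA : ∀ i, K i ≤ A) (hb : ∀ i, b ≤ K i) {i : Fin (n + m)}
    (hs : I.ClinchStep i s s') : I.Invariant K A b ε s' ∧ I.Dispensable s' i ∧
      ∀ k, k ≠ i → I.Dispensable s k → I.Dispensable s' k := by
  obtain ⟨ξ, hξ, rfl⟩ := hs
  have hmem := (I.mem_clinchPolytope_iff h.consistent.feasible).1 hξ.prop
  have hδ0 : 0 ≤ ∑ j, ξ j := Finset.sum_nonneg fun j _ => hmem.1 j
  have hc0 := h.c_nonneg hε i
  have hd : ∀ k, k ≠ i → (I.afterClinch s i ξ).d k = s.d k := fun k hk => by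
    simp [afterClinch, hk]
  have hdi : (I.afterClinch s i ξ).d i + ENNReal.ofReal (∑ j, ξ j) = s.d i := by
    have h1 := hmem.2.1
    rw [h.demand i] at h1 ⊢
    simpa [afterClinch] using demand_add_clinch hc0 (h.pay_nonneg i) hδ0 h1
  have hcl := h.consistent.clinch (d' := (I.afterClinch s i ξ).d) hξ hd hdi.le
  have hle : ∀ k, ENNReal.ofReal ((I.afterClinch s i ξ).x k) + (I.afterClinch s i ξ).d k ≤
      ENNReal.ofReal (s.x k) + s.d k := by
    intro k
    rw [afterClinch_x]
    by_cases hk : k = i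
    · subst hk
      rw [if_pos rfl, ENNReal.ofReal_add (h.x_nonneg k) hδ0, add_assoc, ← hdi,
        add_comm (ENNReal.ofReal (∑ j, ξ j))]
    · simp [hk, hd k hk]
  refine ⟨⟨hcl.1, fun k => ?_, h.turn, h.clock, fun k => ?_, fun k => ?_, fun k => ?_,
    h.history_clinch hε hK hA hb hξ hle⟩, hcl.2, fun k hk hz => ?_⟩
  · by_cases hk : k = i
    · subst hk
      simp [afterClinch]
    · simpa [afterClinch, hk] using h.demand k
  · by_cases hk : k = i
    · subst hk
      have := h.pay_nonneg k
      simp only [afterClinch, Function.update_self]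
      positivity
    · simpa [afterClinch, hk] using h.pay_nonneg k
  · rw [afterClinch_x]
    by_cases hk : k = i
    · subst hk
      have := h.pay_le k
      simp only [afterClinch, Function.update_self, if_true]
      linarith
    · simpa [afterClinch, hk] using h.pay_le k
  · by_cases hk : k = i
    · subst hk
      have h1 := hmem.2.1
      rw [h.demand k] at h1
      simpa [afterClinch] using ofReal_pay_le hc0 (h.pay_nonneg k) hδ0 h1 (h.budget k)
    · simpa [afterClinch, hk] using h.budget k
  · refine h.consistent.fullFuture_clinch hξ.prop hd (fun t ht h1 => ?_) hk hz
    rw [ENNReal.ofReal_add ht hδ0, ← hdi] at h1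
    exact (ENNReal.add_le_add_iff_right ENNReal.ofReal_ne_top).1 h1

theorem Invariant.clinchRound (h : I.Invariant K A b ε s) (hε : 0 < ε)
    (hK : ∀ i, I.value i = K i * ε) (hA : ∀ i, K i ≤ A) (hb : ∀ i, b ≤ K i)
    (hs : I.ClinchRound s s') : I.Invariant K A b ε s' ∧ ∀ k, I.Dispensable s' k := by
  obtain ⟨σ, rfl, rfl, hσ⟩ := hs
  have key : ∀ t : Fin (n + m + 1), I.Invariant K A b ε (σ t) ∧
      ∀ k : Fin (n + m), (k : ℕ) < t → I.Dispensable (σ t) k := by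
    intro t
    induction t using Fin.induction with
    | zero => exact ⟨h, by simp⟩
    | succ i ih =>
      obtain ⟨h1, h2, h3⟩ := ih.1.clinchStep hε hK hA hb (hσ i)
      refine ⟨h1, fun k hk => ?_⟩
      by_cases hki : k = i
      · exact hki ▸ h2
      · refine h3 k hki (ih.2 k ?_)
        have h4 : (k : ℕ) ≠ i := fun h => hki (Fin.ext h)
        simp only [Fin.val_succ, Fin.val_castSucc] at hk ⊢
        omega
  exact ⟨(key (Fin.last _)).1, fun k => (key (Fin.last _)).2 k (by simp)⟩

/-- Only the demand of the buyer whose clock moves changes, and it drops; dispensability lets the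
others take all remaining goods. -/
theorem Invariant.priceUpdate (h : I.Invariant K A b ε s) (hε : 0 < ε)
    (hz : ∀ k, I.Dispensable s k) : I.Invariant K A b ε (I.priceUpdate ε s) := by
  obtain ⟨q, hclock⟩ := h.clock
  have hl := h.turn
  have hx : (I.priceUpdate ε s).x = s.x := rfl
  have hc : ∀ k, s.c k ≤ (I.priceUpdate ε s).c k := fun k => by
    by_cases hk : (k : ℕ) = s.l <;> simp [Market.priceUpdate, hk, hε.le]
  have hd : ∀ k, (I.priceUpdate ε s).d k ≤ s.d k := fun k => by
    by_cases hk : (k : ℕ) = s.l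
    · simp only [Market.priceUpdate, hk, if_true]
      rw [h.demand k]
      exact demand_antitone (h.c_nonneg hε k) (by linarith)
    · simp [Market.priceUpdate, hk]
  refine ⟨h.consistent.lower_demand (l := ⟨s.l, hl⟩) (fun k hk => ?_) (hd _) (hz _), fun k => ?_,
    Nat.mod_lt _ (by omega), ?_, h.pay_nonneg, fun k => ?_, h.budget, ?_⟩
  · have : (k : ℕ) ≠ s.l := fun h => hk (Fin.ext h)
    simp [Market.priceUpdate, this]
  · by_cases hk : (k : ℕ) = s.l
    · simp [Market.priceUpdate, hk]
    · simpa [Market.priceUpdate, hk] using h.demand k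
  · have hcl : ∀ k : Fin (n + m), (I.priceUpdate ε s).c k =
        ((q + if (k : ℕ) < s.l + 1 then 1 else 0 : ℕ) : ℝ) * ε := by
      intro k
      by_cases hk : (k : ℕ) = s.l
      · simp [Market.priceUpdate, hk, hclock]
        ring
      · have : (k : ℕ) < s.l + 1 ↔ (k : ℕ) < s.l := by omega
        simp [Market.priceUpdate, hk, hclock, this]
    rcases (Nat.succ_le_of_lt hl).lt_or_eq with h1 | h1
    · refine ⟨q, fun k => (hcl k).trans ?_⟩
      have : (I.priceUpdate ε s).l = s.l + 1 := Nat.mod_eq_of_lt h1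
      rw [this]
    -- The last buyer has moved: all clocks agree again, one step higher, and the turn returns to
    -- the first buyer.
    · refine ⟨q + 1, fun k => (hcl k).trans ?_⟩
      have h2 : (I.priceUpdate ε s).l = 0 := by
        change (s.l + 1) % (n + m) = 0
        rw [← h1]
        exact Nat.mod_self _
      have h3 : (k : ℕ) < s.l + 1 := k.2.trans_eq h1.symm
      rw [h2, if_pos h3, if_neg (Nat.not_lt_zero _)]
  · exact (h.pay_le k).trans (mul_le_mul_of_nonneg_right (hc k) (h.x_nonneg k))
  · obtain ⟨y, hy⟩ := h.history
    exact ⟨y, hy.zero, hy.nonneg, hy.le, fun i a ha => hy.all i a ((hc i).trans_lt ha), hy.pay,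
      hy.real, fun i a ha => (hy.cert i a ha).mono fun k => by
        rw [hx]
        gcongr
        exact hd k⟩

theorem invariant_of_run (hn : 0 < n + m) (hε : 0 < ε) (hK : ∀ i, I.value i = K i * ε)
    (hA : ∀ i, K i ≤ A) (hb : ∀ i, b ≤ K i)
    (hs : Relation.ReflTransGen (I.Iteration ε) (initState n m) s) : I.Invariant K A b ε s := by
  induction hs with
  | refl => exact invariant_initState hn
  | tail _ hstep ih =>
    obtain ⟨-, t, ht, rfl⟩ := hstep
    obtain ⟨h1, h2⟩ := ih.clinchRound hε hK hA hb ht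
    exact h1.priceUpdate hε h2

end Market

/-! ### Covering deficits by uncrossing. -/

section Covering

variable {α : Type*} {g : Finset α → ℝ} {xf xo : α → ℝ}

/-- The part of the bound `g S` that the vector `x` leaves unused. -/
def slack (g : Finset α → ℝ) (x : α → ℝ) (S : Finset α) : ℝ := g S - ∑ k ∈ S, x k

theorem slack_nonneg {x : α → ℝ} (hx : Independent g x) (S : Finset α) : 0 ≤ slack g x S :=
  sub_nonneg.2 (hx.2 S)

variable [DecidableEq α]

theorem slack_union_add_slack_inter_le (hg : IsPolymatroid g) (x : α → ℝ) (S T : Finset α) :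
    slack g x (S ∪ T) + slack g x (S ∩ T) ≤ slack g x S + slack g x T := by
  have h1 := hg.submod S T
  have h2 := Finset.sum_union_inter (s₁ := S) (s₂ := T) (f := x)
  unfold slack
  linarith

theorem slack_inter_le (hg : IsPolymatroid g) {x : α → ℝ} (hx : Independent g x)
    (S T : Finset α) : slack g x (S ∩ T) ≤ slack g x S + slack g x T := by
  have h1 := slack_union_add_slack_inter_le hg x S T
  have h2 := slack_nonneg hx (S ∪ T)
  linarith

/-- Outside a set `U` that is tight for `xo`, the deficits of `xf` with respect to `xo` exceed the
excesses by at most a difference of slacks. -/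
theorem sum_deficit_sdiff_le (hg : IsPolymatroid g) (ho : Independent g xo) {U : Finset α}
    (hU : ∑ k ∈ U, xo k = g U) (C : Finset α) :
    ∑ k ∈ C \ U, max 0 (xo k - xf k) ≤
      ∑ k ∈ C \ U, max 0 (xf k - xo k) + slack g xf C - slack g xf (C ∩ U) := by
  have h1 : ∑ k ∈ C \ U, max 0 (xo k - xf k) =
      ∑ k ∈ C \ U, max 0 (xf k - xo k) + ∑ k ∈ C \ U, (xo k - xf k) := by
    rw [← Finset.sum_add_distrib]
    refine Finset.sum_congr rfl fun k _ => ?_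
    rcases le_total (xo k) (xf k) with h | h
    · rw [max_eq_left (by linarith), max_eq_right (by linarith)]
      ring
    · rw [max_eq_right (by linarith), max_eq_left (by linarith)]
      ring
  have h2 : ∀ u : α → ℝ, ∑ k ∈ C ∪ U, u k = ∑ k ∈ C \ U, u k + ∑ k ∈ U, u k := fun u => by
    rw [← Finset.union_sdiff_right, Finset.sum_sdiff Finset.subset_union_right]
  have h3 := ho.2 (C ∪ U)
  have h4 := slack_union_add_slack_inter_le hg xf C U
  have h5 := h2 xo
  have h6 := h2 xf
  unfold slack at *
  rw [h1, Finset.sum_sub_distrib]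
  linarith

/-- The deficits on `Λ ∩ C` are covered by the amounts `X` of the elements of `I` and the excesses
of the other elements of `C`, up to the slack of `C`. -/
def Covers (g : Finset α → ℝ) (xf xo X : α → ℝ) (Λ I : Finset α) : Prop :=
  ∀ C, ∑ k ∈ Λ ∩ C, max 0 (xo k - xf k) ≤
    ∑ i ∈ I, X i + ∑ k ∈ C \ I, max 0 (xf k - xo k) + slack g xf C

/-- Split `C` by `T`: the certificate pays for the deficits outside `T`, the old covering for those
in `C ∩ T`. The slack of `C ∩ T` is at most that of `C` plus that of `T`, and the certificate has
the latter to spare. -/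
theorem Covers.insert (hg : IsPolymatroid g) (hf : Independent g xf) {X : α → ℝ}
    {Λ I : Finset α} (h : Covers g xf xo X Λ I) {i : α} (hi : i ∉ I) {T : Finset α} (hT : i ∉ T)
    (hX : ∀ Q ⊆ Λ, ∑ k ∈ Q \ T, max 0 (xo k - xf k) ≤ X i - slack g xf T) :
    Covers g xf xo X Λ (insert i I) := by
  intro C
  have h1 := hX (Λ ∩ C) Finset.inter_subset_left
  have h2 := h (C ∩ T)
  have h3 := slack_inter_le hg hf C T
  have h4 := Finset.sum_inter_add_sum_sdiff (Λ ∩ C) T fun k => max 0 (xo k - xf k)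
  have h5 : ∑ k ∈ (C ∩ T) \ I, max 0 (xf k - xo k) ≤
      ∑ k ∈ C \ Insert.insert i I, max 0 (xf k - xo k) := by
    refine Finset.sum_le_sum_of_subset_of_nonneg (fun k hk => ?_) fun _ _ _ => le_max_left _ _
    simp only [Finset.mem_sdiff, Finset.mem_inter, Finset.mem_insert, not_or] at hk ⊢
    exact ⟨hk.1.1, fun h => hT (h ▸ hk.1.2), hk.2⟩
  rw [Finset.sum_insert hi]
  rw [Finset.inter_assoc] at h4
  linarith

/-- Here a certificate controls only buyers in tight sets `U i'` with `i ≤ i'`. The smallest index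
is therefore added last, when the union V of all tight sets qualifies. Outside V, tightness for `xo`
balances deficits against excesses; in V outside `T i` the certificate pays; on the rest the
induction hypothesis applies. The slacks telescope. -/
theorem covers_of_tight {α : Type*} [LinearOrder α] {g : Finset α → ℝ} {xf xo : α → ℝ}
    (hg : IsPolymatroid g) (hf : Independent g xf) (ho : Independent g xo) {X : α → ℝ}
    {Λ : Finset α} {T U : α → Finset α} (I : Finset α)
    (hT : ∀ i ∈ I, i ∉ T i) (hiU : ∀ i ∈ I, i ∈ U i) (hU : ∀ i ∈ I, ∑ k ∈ U i, xo k = g (U i))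
    (hX : ∀ i ∈ I, ∀ Q ⊆ Λ, (∀ k ∈ Q, ∃ i' ∈ I, i ≤ i' ∧ k ∈ U i') →
      ∑ k ∈ Q \ T i, max 0 (xo k - xf k) ≤ X i - slack g xf (T i)) :
    Covers g xf xo X Λ I := by
  induction I using Finset.induction_on_min with
  | empty =>
    intro C
    have h1 := sum_deficit_sdiff_le (xf := xf) hg ho (U := ∅) (by simp [hg.empty]) C
    have h2 : ∑ k ∈ Λ ∩ C, max 0 (xo k - xf k) ≤ ∑ k ∈ C, max 0 (xo k - xf k) :=
      Finset.sum_le_sum_of_subset_of_nonneg Finset.inter_subset_right fun _ _ _ => le_max_left _ _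
    simp only [Finset.sdiff_empty, Finset.inter_empty] at h1
    have h3 := slack_nonneg hf ∅
    simp only [Finset.sum_empty, Finset.sdiff_empty]
    linarith
  | insert i I hmin ih =>
    have hiI : i ∉ I := fun h => lt_irrefl _ (hmin i h)
    have ih := ih (fun k hk => hT k (Finset.mem_insert_of_mem hk))
      (fun k hk => hiU k (Finset.mem_insert_of_mem hk))
      (fun k hk => hU k (Finset.mem_insert_of_mem hk))
      fun k hk Q hQ h => hX k (Finset.mem_insert_of_mem hk) Q hQ fun x hx => by
        obtain ⟨i', hi', h'⟩ := h x hx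
        exact ⟨i', Finset.mem_insert_of_mem hi', h'⟩
    have hV : ∀ J ⊆ insert i I, ∑ k ∈ J.biUnion U, xo k = g (J.biUnion U) := by
      intro J
      induction J using Finset.induction_on with
      | empty => simp [hg.empty]
      | insert j J _ ihJ =>
        intro hJ
        rw [Finset.biUnion_insert]
        exact tight_union hg ho (hU j (hJ (Finset.mem_insert_self _ _)))
          (ihJ ((Finset.subset_insert _ _).trans hJ))
    intro C
    set V := (insert i I).biUnion U with hVdef
    have hVmem : ∀ j ∈ insert i I, j ∈ V := fun j hj =>
      Finset.mem_biUnion.2 ⟨j, hj, hiU j hj⟩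
    have h1 := sum_deficit_sdiff_le (xf := xf) hg ho (hV _ subset_rfl) C
    rw [← hVdef] at h1
    have h2 := hX i (Finset.mem_insert_self _ _) (Λ ∩ (C ∩ V)) Finset.inter_subset_left (by
      intro k hk
      have hkV := (Finset.mem_inter.1 (Finset.mem_inter.1 hk).2).2
      obtain ⟨j, hj, hkj⟩ := Finset.mem_biUnion.1 hkV
      refine ⟨j, hj, ?_, hkj⟩
      rcases Finset.mem_insert.1 hj with rfl | hj
      · exact le_rfl
      · exact (hmin j hj).le)
    have h3 := ih (C ∩ V ∩ T i)
    have h4 := slack_inter_le hg hf (C ∩ V) (T i)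
    have h5 := Finset.sum_inter_add_sum_sdiff (Λ ∩ C) V fun k => max 0 (xo k - xf k)
    have h6 := Finset.sum_inter_add_sum_sdiff (Λ ∩ (C ∩ V)) (T i) fun k => max 0 (xo k - xf k)
    have h7 : ∑ k ∈ (Λ ∩ C) \ V, max 0 (xo k - xf k) ≤ ∑ k ∈ C \ V, max 0 (xo k - xf k) :=
      Finset.sum_le_sum_of_subset_of_nonneg
        (Finset.sdiff_subset_sdiff Finset.inter_subset_right subset_rfl)
        fun _ _ _ => le_max_left _ _
    have h8 : ∑ k ∈ C \ V, max 0 (xf k - xo k) +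
        ∑ k ∈ (C ∩ V ∩ T i) \ I, max 0 (xf k - xo k) ≤
        ∑ k ∈ C \ insert i I, max 0 (xf k - xo k) := by
      rw [← Finset.sum_union]
      · refine Finset.sum_le_sum_of_subset_of_nonneg (fun k hk => ?_) fun _ _ _ => le_max_left _ _
        rcases Finset.mem_union.1 hk with hk | hk
        · rw [Finset.mem_sdiff] at hk ⊢
          exact ⟨hk.1, fun h => hk.2 (hVmem k h)⟩
        · simp only [Finset.mem_sdiff, Finset.mem_inter, Finset.mem_insert, not_or] at hk ⊢
          exact ⟨hk.1.1.1, fun h => hT i (Finset.mem_insert_self _ _) (h ▸ hk.1.2), hk.2⟩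
      · refine Finset.disjoint_left.2 fun k hk hk' => ?_
        simp only [Finset.mem_sdiff, Finset.mem_inter] at hk hk'
        exact hk.2 hk'.1.1.2
    rw [Finset.inter_assoc] at h5 h6
    rw [Finset.sum_insert hiI]
    rw [Finset.inter_assoc] at h3 h4 h6 h8
    linarith

end Covering

/-! ### From levels to payments. -/

namespace Market

variable {n m : ℕ} {I : Market n m} {K : Fin (n + m) → ℕ} {A b : ℕ} {ε : ℝ}
  {s : AuctionState n m} {y : Fin (n + m) → ℕ → ℝ}

/-- With zero demands the only future is zero, and some future sells everything. -/
theorem Invariant.sum_x_eq_total (h : I.Invariant K A b ε s) (hd : ∀ i, s.d i = 0) :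
    ∑ k, s.x k = I.total Finset.univ := by
  obtain ⟨z, hz, hsum⟩ := h.consistent.full
  have h0 : ∀ k, z k = 0 := fun k =>
    le_antisymm (by simpa [hd k] using hz.le k) (hz.nonneg k)
  simp only [h0, add_zero] at hsum
  exact hsum

/-- In a final state, a certificate bounds the deficits outside its set `T`. -/
theorem Certificate.sum_deficit_le (hsum : ∑ k, s.x k = I.total Finset.univ)
    (hd : ∀ i, s.d i = 0) {i : Fin (n + m)} {a : ℕ} {t : ℝ} (h : I.Certificate K s i a t) :
    ∃ q T, q < a ∧ q < K i ∧ i ∉ T ∧ ∀ Q : Finset (Fin (n + m)),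
      (∀ k ∈ Q, k ≠ i ∧ (q + 2 ≤ K k ∨ (q + 1 ≤ K k ∧ i < k))) →
      ∑ k ∈ Q \ T, max 0 (I.xOpt k - s.x k) ≤ s.x i - t - slack I.total s.x T := by
  obtain ⟨q, T, M, hqa, hqK, hiT, hM0, hM, htot, hopt⟩ := h
  refine ⟨q, T, hqa, hqK, hiT, fun Q hQ => ?_⟩
  have hxM : ∀ k, k ∉ T → k ≠ i → s.x k ≤ M k := fun k hk hki => by
    have := hM k hk hki
    rwa [hd k, add_zero, ENNReal.ofReal_le_ofReal_iff (hM0 k)] at this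
  have h1 : ∑ k ∈ Q \ T, max 0 (I.xOpt k - s.x k) ≤ ∑ k ∈ Q \ T, (M k - s.x k) := by
    refine Finset.sum_le_sum fun k hk => ?_
    obtain ⟨hkQ, hkT⟩ := Finset.mem_sdiff.1 hk
    obtain ⟨hki, hcond⟩ := hQ k hkQ
    have h2 := hopt k hkT hki hcond
    have h3 := hxM k hkT hki
    exact max_le (by linarith) (by linarith)
  have h2 : ∑ k ∈ Q \ T, (M k - s.x k) ≤ ∑ k ∈ Tᶜ.erase i, (M k - s.x k) := by
    refine Finset.sum_le_sum_of_subset_of_nonneg (fun k hk => ?_) fun k hk _ => ?_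
    · obtain ⟨hkQ, hkT⟩ := Finset.mem_sdiff.1 hk
      exact Finset.mem_erase.2 ⟨(hQ k hkQ).1, Finset.mem_compl.2 hkT⟩
    · obtain ⟨hki, hkT⟩ := Finset.mem_erase.1 hk
      exact sub_nonneg.2 (hxM k (Finset.mem_compl.1 hkT) hki)
  -- All goods are sold, so the total gap between `M` and the final amounts outside `T` is what `i`
  -- bought beyond `t`, minus the slack of `T`.
  have h3 := Finset.add_sum_erase Tᶜ s.x (Finset.mem_compl.2 hiT)
  have h4 := Finset.sum_add_sum_compl T s.x
  have h5 := Finset.sum_sub_distrib (s := Tᶜ.erase i) M s.x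
  unfold slack
  linarith

/-- The buyers whose greedy amount exhausts their budget. -/
def BudgetLimited (I : Market n m) (i : Fin (n + m)) : Prop :=
  I.budget i ≠ ⊤ ∧ I.value i * I.xOpt i = (I.budget i).toReal

open Classical in
/-- The deficits of the buyers whose value is at least `a` price increments are covered by what
the buyers with an excess have bought at high prices. -/
theorem Invariant.sum_deficit_level_le (h : I.Invariant K A b ε s) (hε : 0 < ε)
    (hK : ∀ i, I.value i = K i * ε) (hd : ∀ i, s.d i = 0) (hy : I.History K A b ε s y) (a : ℕ) :
    ∑ k with s.x k ≤ I.xOpt k ∧ a + 1 ≤ K k, (I.xOpt k - s.x k) ≤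
      ∑ i with I.xOpt i < s.x i, if I.BudgetLimited i
        then min (s.x i - y i a) (s.x i - I.xOpt i) else s.x i - y i (a + 1) := by
  have hsum := h.sum_x_eq_total hd
  have hf : Independent I.total s.x := I.independent_total_of_mem_feasible h.consistent.feasible
  have ho : Independent I.total I.xOpt := independent_xOpt
  have hg := I.isPolymatroid_total
  -- A budget-limited buyer uses a certificate from below a steps, which controls all values of at
  -- least a + 1. The others use one from at most a steps, so that their later purchases match the
  -- payment sum.
  set τ : Fin (n + m) → ℕ := fun i => if I.BudgetLimited i then a else a + 1 with hτ
  set X : Fin (n + m) → ℝ := fun i => s.x i - y i (τ i) with hX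
  set Λ := Finset.univ.filter fun k => s.x k ≤ I.xOpt k ∧ a + 1 ≤ K k with hΛ
  -- Only buyers whose late purchases fall short of their excess need certificates; the excess
  -- itself is charged to the others.
  set bad := Finset.univ.filter fun i => I.xOpt i < s.x i ∧ X i < s.x i - I.xOpt i with hbad
  have hbadmem : ∀ i, i ∈ bad ↔ I.xOpt i < s.x i ∧ X i < s.x i - I.xOpt i := fun i => by
    simp [hbad]
  have hΛmem : ∀ k, k ∈ Λ ↔ s.x k ≤ I.xOpt k ∧ a + 1 ≤ K k := fun k => by simp [hΛ]
  have hne : ∀ i ∈ bad, ∀ k ∈ Λ, k ≠ i := by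
    rintro i hi k hk rfl
    have h1 := ((hbadmem _).1 hi).1
    have h2 := ((hΛmem _).1 hk).1
    linarith
  have hcert : ∀ i, ∃ (q : ℕ) (T : Finset (Fin (n + m))), i ∈ bad → q < τ i ∧ q < K i ∧ i ∉ T ∧
      ∀ Q : Finset (Fin (n + m)),
      (∀ k ∈ Q, k ≠ i ∧ (q + 2 ≤ K k ∨ (q + 1 ≤ K k ∧ i < k))) →
      ∑ k ∈ Q \ T, max 0 (I.xOpt k - s.x k) ≤ X i - slack I.total s.x T := by
    intro i
    by_cases hi : i ∈ bad
    · have h1 := ((hbadmem i).1 hi).2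
      have h2 := xOpt_nonneg (I := I) i
      -- A bad buyer bought more than her greedy amount early on, so a certificate exists.
      have h3 : 0 < y i (τ i) := by
        simp only [hX] at h1
        linarith
      obtain ⟨q, T, h4⟩ := (hy.cert i _ h3).sum_deficit_le hsum hd
      exact ⟨q, T, fun _ => h4⟩
    · exact ⟨0, ∅, fun h => absurd h hi⟩
  choose q T hqT using hcert
  have htight : ∀ i, ∃ U, ¬ I.BudgetLimited i →
      i ∈ U ∧ U ⊆ insert i (I.before i) ∧ ∑ k ∈ U, I.xOpt k = I.total U := by
    intro i
    rcases xOpt_dichotomy (I := I) i with h1 | ⟨U, hU⟩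
    · exact ⟨∅, fun h => absurd h1 h⟩
    · exact ⟨U, fun _ => hU⟩
  choose U hU using htight
  -- These are the buyers whose certificate may come from exactly a steps, where ties in value a + 1
  -- matter.
  set J := bad.filter fun i => ¬ I.BudgetLimited i ∧ a + 1 ≤ K i with hJ
  have hJmem : ∀ i ∈ J, i ∈ bad ∧ ¬ I.BudgetLimited i ∧ a + 1 ≤ K i := fun i hi => by
    simpa [hJ] using hi
  have hcovJ : Covers I.total s.x I.xOpt X Λ J := by
    refine covers_of_tight (T := T) (U := U) hg hf ho J (fun i hi => (hqT i (hJmem i hi).1).2.2.1)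
      (fun i hi => (hU i (hJmem i hi).2.1).1) (fun i hi => (hU i (hJmem i hi).2.1).2.2)
      fun i hi Q hQ hQU => ?_
    obtain ⟨hib, hiB, -⟩ := hJmem i hi
    obtain ⟨h1, -, -, h2⟩ := hqT i hib
    refine h2 Q fun k hk => ⟨hne i hib k (hQ hk), ?_⟩
    have h3 := ((hΛmem k).1 (hQ hk)).2
    have h4 : τ i = a + 1 := if_neg hiB
    by_cases h5 : q i + 2 ≤ K k
    · exact Or.inl h5
    -- Now q = a and `K k` = a + 1 ≤ `K i'`. As `k` precedes `i'` in the greedy order, the values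
    -- are equal and `k` > `i'` ≥ `i`.
    · refine Or.inr ⟨by omega, ?_⟩
      obtain ⟨i', hi', hii', hkU⟩ := hQU k hk
      obtain ⟨hib', hiB', hiK'⟩ := hJmem i' hi'
      have h6 := (Finset.mem_insert.1 ((hU i' hiB').2.1 hkU)).resolve_left
        (hne i' hib' k (hQ hk))
      simp only [before, Finset.mem_filter, Finset.mem_univ, true_and, hK] at h6
      have h7 : (K k : ℝ) * ε ≤ K i' * ε := by
        have : K k ≤ K i' := by omega
        gcongr
      rcases h6 with h6 | h6
      · linarith
      · exact lt_of_le_of_lt hii' h6.2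
  -- The remaining bad buyers have q < a: either τ = a, or q < `K i` ≤ a. So their certificates
  -- control all of Λ.
  have hcov : ∀ R ⊆ bad \ J, Covers I.total s.x I.xOpt X Λ (R ∪ J) := by
    intro R
    induction R using Finset.induction_on with
    | empty =>
      intro _
      rwa [Finset.empty_union]
    | insert i R hiR ih =>
      intro hR
      obtain ⟨hib, hiJ⟩ := Finset.mem_sdiff.1 (hR (Finset.mem_insert_self _ _))
      obtain ⟨h1, h2, h3, h4⟩ := hqT i hib
      rw [Finset.insert_union]
      refine (ih ((Finset.subset_insert _ _).trans hR)).insert hg hf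
        (by simp [hiR, hiJ]) h3 fun Q hQ => h4 Q fun k hk => ⟨hne i hib k (hQ hk), Or.inl ?_⟩
      have h5 := ((hΛmem k).1 (hQ hk)).2
      by_cases h6 : I.BudgetLimited i
      · have : τ i = a := if_pos h6
        omega
      · have : ¬ (a + 1 ≤ K i) := fun h7 => hiJ (Finset.mem_filter.2 ⟨hib, h6, h7⟩)
        omega
  have hfinal := hcov _ subset_rfl Finset.univ
  rw [Finset.sdiff_union_of_subset (Finset.filter_subset _ _), Finset.inter_univ] at hfinal
  have h1 : slack I.total s.x Finset.univ = 0 := by simp [slack, hsum]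
  have h2 : ∑ k ∈ Λ, max 0 (I.xOpt k - s.x k) = ∑ k ∈ Λ, (I.xOpt k - s.x k) :=
    Finset.sum_congr rfl fun k hk => max_eq_right (by linarith [((hΛmem k).1 hk).1])
  rw [h1, h2, add_zero] at hfinal
  refine hfinal.trans ?_
  rw [← Finset.sum_filter_add_sum_filter_not (Finset.univ.filter fun i => I.xOpt i < s.x i)
    (· ∈ bad)]
  have h3 : (Finset.univ.filter fun i => I.xOpt i < s.x i).filter (· ∈ bad) = bad := by
    ext i
    simp only [Finset.mem_filter, Finset.mem_univ, true_and, hbadmem]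
    tauto
  rw [h3]
  refine add_le_add (Finset.sum_le_sum fun i hi => ?_) ?_
  · have h4 := ((hbadmem i).1 hi).2
    by_cases h6 : I.BudgetLimited i
    · have h5 : τ i = a := if_pos h6
      rw [if_pos h6]
      simp only [hX, h5] at h4 ⊢
      exact le_min le_rfl h4.le
    · have h5 : τ i = a + 1 := if_neg h6
      rw [if_neg h6]
      simp only [hX, h5, le_refl]
  · rw [← Finset.sum_filter_add_sum_filter_not (Finset.univ \ bad)
      (fun i => I.xOpt i < s.x i)]
    have h4 : ∑ k ∈ (Finset.univ \ bad).filter (fun i => ¬ I.xOpt i < s.x i),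
        max 0 (s.x k - I.xOpt k) = 0 := by
      refine Finset.sum_eq_zero fun k hk => max_eq_left ?_
      linarith [not_lt.1 (Finset.mem_filter.1 hk).2]
    have h5 : (Finset.univ \ bad).filter (fun i => I.xOpt i < s.x i) =
        (Finset.univ.filter fun i => I.xOpt i < s.x i).filter (· ∉ bad) := by
      ext i
      simp [and_comm]
    rw [h4, add_zero, h5]
    refine Finset.sum_le_sum fun i hi => ?_
    simp only [Finset.mem_filter, Finset.mem_univ, true_and, hbadmem, not_and, not_lt] at hi
    have h6 := hi.2 hi.1
    rw [max_eq_right (by linarith [hi.1])]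
    by_cases h7 : I.BudgetLimited i
    · have h8 : τ i = a := if_pos h7
      rw [if_pos h7]
      simp only [hX, h8] at h6
      exact le_min h6 le_rfl
    · have h8 : τ i = a + 1 := if_neg h7
      rw [if_neg h7]
      simp only [hX, h8] at h6
      exact h6

/-- What a budget-limited buyer with an excess contributes on all levels is at most her payment. -/
theorem Invariant.sum_min_le_pay (h : I.Invariant K A b ε s) (hε : 0 < ε)
    (hb0 : 0 < b) (hbA : b ≤ A) (hy : I.History K A b ε s y) {i : Fin (n + m)}
    (hv : ε * I.value i ≤ (b * ε) ^ 2 + ε * (b * ε)) (hB : I.BudgetLimited i)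
    (hx : I.xOpt i < s.x i) :
    ε * ∑ a ∈ Finset.range A, min (s.x i - y i a) (s.x i - I.xOpt i) ≤ s.p i := by
  obtain ⟨hBtop, hBeq⟩ := hB
  have hreal : ∀ a ≤ b, y i a = 0 := by
    refine Fin.addCases (motive := fun i => I.budget i ≠ ⊤ → ∀ a ≤ b, y i a = 0)
      (fun i₀ _ a ha => hy.real i₀ a ha) (fun j hj => ?_) i hBtop
    exact absurd (by simp [Market.budget]) hj
  have hF : ∀ a, 0 ≤ s.x i - y i a := fun a => sub_nonneg.2 (hy.le i a)
  have hpay := hy.pay i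
  -- Nothing is bought at prices below b steps, so each of the first b terms of the payment sum is
  -- the full amount.
  have hlow : ∀ A', b ≤ A' → b * s.x i ≤ ∑ a ∈ Finset.range A', (s.x i - y i (a + 1)) := by
    intro A' hA'
    induction A', hA' using Nat.le_induction with
    | base =>
      rw [Finset.sum_congr rfl fun a ha => by
        rw [hreal (a + 1) (by simpa [Nat.succ_le_iff] using ha), sub_zero]]
      simp
    | succ A' _ ih =>
      rw [Finset.sum_range_succ]
      linarith [hF (A' + 1)]
  -- The terms 0, …, b are bounded by the excess; each later term a + 1 is at most the payment term
  -- with index a.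
  have hup : ∀ A', b ≤ A' → ∑ a ∈ Finset.range (A' + 1), min (s.x i - y i a) (s.x i - I.xOpt i) ≤
      (b + 1) * (s.x i - I.xOpt i) + ∑ a ∈ Finset.range A', (s.x i - y i (a + 1)) - b * s.x i := by
    intro A' hA'
    induction A', hA' using Nat.le_induction with
    | base =>
      have h1 : ∑ a ∈ Finset.range (b + 1), min (s.x i - y i a) (s.x i - I.xOpt i) ≤
          ∑ a ∈ Finset.range (b + 1), (s.x i - I.xOpt i) :=
        Finset.sum_le_sum fun a _ => min_le_right _ _
      have h2 := hlow b le_rfl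
      simp only [Finset.sum_const, Finset.card_range, nsmul_eq_mul, Nat.cast_add,
        Nat.cast_one] at h1
      linarith
    | succ A' _ ih =>
      rw [Finset.sum_range_succ (n := A' + 1), Finset.sum_range_succ
        (fun a => s.x i - y i (a + 1)) A']
      linarith [min_le_left (s.x i - y i (A' + 1)) (s.x i - I.xOpt i)]
  have h1 := hup A hbA
  rw [Finset.sum_range_succ] at h1
  have h2 : 0 ≤ min (s.x i - y i A) (s.x i - I.xOpt i) := le_min (hF A) (by linarith)
  have h3 := hlow A hbA
  -- the budget limits the amount bought
  have h4 : s.p i ≤ I.value i * I.xOpt i := by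
    rw [hBeq]
    exact (ENNReal.ofReal_le_iff_le_toReal hBtop).1 (h.budget i)
  have hb' : (0 : ℝ) < b := by exact_mod_cast hb0
  have hV : 0 < b * ε := mul_pos hb' hε
  have h5 : b * ε * s.x i ≤ I.value i * I.xOpt i := by
    refine le_trans ?_ h4
    rw [hpay]
    calc b * ε * s.x i = ε * (b * s.x i) := by ring
      _ ≤ _ := mul_le_mul_of_nonneg_left h3 hε.le
  -- From v_min x ≤ v x* and ε v ≤ v_min (v_min + ε): this absorbs the extra term caused by the
  -- shift of levels.
  have h6 : ε * s.x i ≤ (b * ε + ε) * I.xOpt i := by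
    refine le_of_mul_le_mul_left ?_ hV
    calc b * ε * (ε * s.x i) = ε * (b * ε * s.x i) := by ring
      _ ≤ ε * (I.value i * I.xOpt i) := mul_le_mul_of_nonneg_left h5 hε.le
      _ = ε * I.value i * I.xOpt i := by ring
      _ ≤ ((b * ε) ^ 2 + ε * (b * ε)) * I.xOpt i :=
        mul_le_mul_of_nonneg_right hv (xOpt_nonneg i)
      _ = _ := by ring
  rw [hpay]
  have h7 : ε * ((b + 1) * (s.x i - I.xOpt i) - b * s.x i) ≤ 0 := by
    have : ε * ((b + 1) * (s.x i - I.xOpt i) - b * s.x i) =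
        ε * s.x i - (b * ε + ε) * I.xOpt i := by ring
    linarith
  have h8 : ∑ a ∈ Finset.range A, min (s.x i - y i a) (s.x i - I.xOpt i) ≤
      ((b + 1) * (s.x i - I.xOpt i) - b * s.x i) +
        ∑ a ∈ Finset.range A, (s.x i - y i (a + 1)) := by linarith
  have h9 := mul_le_mul_of_nonneg_left h8 hε.le
  rw [mul_add] at h9
  linarith

-- Summation over the levels: each unit of deficit of `k` is counted at `K k` levels, and exchanging
-- the sums turns the right-hand sides into payments, exactly or by the budget estimate.
open Classical in
theorem Invariant.sum_deficit_le_sum_pay (h : I.Invariant K A b ε s) (hε : 0 < ε)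
    (hK : ∀ i, I.value i = K i * ε) (hA : ∀ i, K i ≤ A) (hb0 : 0 < b) (hbA : b ≤ A)
    (hv : ∀ i, ε * I.value i ≤ (b * ε) ^ 2 + ε * (b * ε)) (hd : ∀ i, s.d i = 0) :
    ∑ k with s.x k ≤ I.xOpt k, I.value k * (I.xOpt k - s.x k) ≤
      ∑ i with I.xOpt i < s.x i, s.p i := by
  obtain ⟨y, hy⟩ := h.history
  have h1 : ∀ k, I.value k * (I.xOpt k - s.x k) =
      ε * ∑ a ∈ Finset.range A, if a + 1 ≤ K k then I.xOpt k - s.x k else 0 := by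
    intro k
    have h2 : (Finset.range A).filter (fun a => a + 1 ≤ K k) = Finset.range (K k) := by
      ext a
      have := hA k
      simp only [Finset.mem_filter, Finset.mem_range]
      omega
    rw [← Finset.sum_filter, h2, Finset.sum_const, Finset.card_range, nsmul_eq_mul, hK]
    ring
  calc ∑ k with s.x k ≤ I.xOpt k, I.value k * (I.xOpt k - s.x k)
      = ε * ∑ a ∈ Finset.range A,
          ∑ k with s.x k ≤ I.xOpt k ∧ a + 1 ≤ K k, (I.xOpt k - s.x k) := by
        rw [Finset.sum_congr rfl fun k _ => h1 k, ← Finset.mul_sum, Finset.sum_comm]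
        congr 1
        refine Finset.sum_congr rfl fun a _ => ?_
        rw [← Finset.sum_filter, Finset.filter_filter]
    _ ≤ ε * ∑ a ∈ Finset.range A, ∑ i with I.xOpt i < s.x i, (if I.BudgetLimited i
          then min (s.x i - y i a) (s.x i - I.xOpt i) else s.x i - y i (a + 1)) := by
        refine mul_le_mul_of_nonneg_left (Finset.sum_le_sum fun a _ => ?_) hε.le
        exact h.sum_deficit_level_le hε hK hd hy a
    _ = ∑ i with I.xOpt i < s.x i, ε * ∑ a ∈ Finset.range A, (if I.BudgetLimited i
          then min (s.x i - y i a) (s.x i - I.xOpt i) else s.x i - y i (a + 1)) := by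
        rw [Finset.sum_comm, Finset.mul_sum]
    _ ≤ _ := by
        refine Finset.sum_le_sum fun i hi => ?_
        by_cases hB : I.BudgetLimited i
        · simp only [hB, if_true]
          exact h.sum_min_le_pay hε hb0 hbA hy (hv i) hB (Finset.mem_filter.1 hi).2
        · simp only [hB, if_false]
          exact (hy.pay i).ge

end Market

theorem theorem3p8 {n m : ℕ} (hn : 0 < n) (hm : 0 < m) (I : Market n m) (ε : ℝ) (hε : 0 < ε)
    (hmul : ∀ i, ∃ k : ℕ, I.value i = k * ε)
    (hsmall : I.vMax = I.vMin ∨ ε ≤ I.vMin ^ 2 / (I.vMax - I.vMin))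
    (s : AuctionState n m) (hs : I.IsFinalState ε s) :
    (∑ i with I.xOpt i < s.x i, s.p i) + (∑ i with s.x i ≤ I.xOpt i, I.value i * s.x i) ≥
      ∑ i with s.x i ≤ I.xOpt i, I.value i * I.xOpt i := by
  choose K hK using hmul
  have hne : Nonempty (Fin (n + m)) := ⟨⟨0, by omega⟩⟩
  obtain ⟨i₀, hi₀⟩ := Finite.exists_min K
  have hmin : I.vMin = K i₀ * ε := by
    rw [← hK]
    refine le_antisymm (ciInf_le (Set.finite_range _).bddBelow i₀) (le_ciInf fun i => ?_)
    rw [hK, hK]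
    have := hi₀ i
    gcongr
  have hmax : ∀ i, I.value i ≤ I.vMax := fun i => le_ciSup (Set.finite_range _).bddAbove i
  have hpos : 0 < K i₀ := by
    have h1 := Market.value_pos (I := I) i₀
    rw [hK] at h1
    exact_mod_cast pos_of_mul_pos_left h1 hε.le
  have hgap : ε * (I.vMax - I.vMin) ≤ I.vMin ^ 2 := by
    rcases eq_or_ne I.vMax I.vMin with h | h
    · rw [h, sub_self, mul_zero]
      positivity
    · have h1 : 0 < I.vMax - I.vMin := by
        have h2 := hmax i₀
        rw [hK, ← hmin] at h2
        exact sub_pos.2 (lt_of_le_of_ne h2 h.symm)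
      exact (le_div_iff₀ h1).1 (hsmall.resolve_left h)
  have hA : ∀ i, K i ≤ Finset.univ.sup K := fun i => Finset.le_sup (Finset.mem_univ i)
  have hinv := Market.invariant_of_run (K := K) (A := Finset.univ.sup K) (b := K i₀)
    (by omega) hε hK hA hi₀ hs.1
  -- With b = v_min / ε, the condition ε v_i ≤ v_min² + ε v_min is the gap bound together with v_i ≤
  -- v_max.
  have hkey := hinv.sum_deficit_le_sum_pay hε hK hA hpos (hA i₀) (fun i => by
    have h1 := mul_le_mul_of_nonneg_left (hmax i) hε.le
    rw [← hmin]
    linarith) hs.2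
  simp only [mul_sub, Finset.sum_sub_distrib] at hkey
  linarith
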